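/- Let $E$ be the shift, $(Ea)(n)=a(n+1)$, on complex sequences over $\mathbb Z$. Let $W=\ell^2(\mathbb Z;\mathbb C)$ with the bilinear product $\langle a,b\rangle=\sum_n a(n)b(n)$; $A^*$ denotes the transpose of an operator $A$ with respect to it. Formal shift operators $A=\sum_{j\le d}a_j(n)E^j$ are multiplied by the rule $E^ja=(E^ja)E^j$. Put $A_+=\sum_{j\ge0}a_jE^j$, $A_{>0}=\sum_{j>0}a_jE^j$, $\operatorname{Tr}A=\sum_n a_0(n)$, $(A,B)=\operatorname{Tr}(AB)$. As formal operators, $u(E-1)^{-1}v=\sum_{j\ge1}uE^{-j}v$ and $uE(E-1)^{-1}v=\sum_{j\ge0}uE^{-j}v$. On summable sequences $(E-1)^{-1}$ acts by $$((E-1)^{-1}a)(n)=\tfrac12\Big(\sum_{r<n}a(r)-\sum_{r\ge n}a(r)\Big),$$ the inverse of $E-1$ whose transpose is $(E^{-1}-1)^{-1}=-E(E-1)^{-1}$. Fix integers $N,m,s\ge1$ and $k\in\{1,\dots,N\}$. The phase space $\mathcal P$ consists of the triples $(l,\mathrm f,\mathrm f^*)$ with $\mathrm f=(f_1,\dots,f_N)$,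 $\mathrm f^*=(f_1^*,\dots,f_N^*)$ in $W^N$ and $$l=l_{>0}+\sum_{i=1}^Nf_iE(E-1)^{-1}f_i^*,\qquad l_{>0}=E^m+\sum_{0<j<m}a_jE^j,\qquad a_j\in\ell^1(\mathbb Z;\mathbb C).$$ It is parametrized by $(l_{>0},\mathrm f,\mathrm f^*)$. A variation of these coordinates consists of $\delta l_{>0}=\sum_{0<j<m}b_jE^j$ with $b_j\in\ell^1$ and $\delta f_i,\delta f_i^*\in W$. It gives the tangent vector $(\delta l,\delta\mathrm f,\delta\mathrm f^*)$, where $\delta l=\delta l_{>0}+\sum_i\big(\delta f_i\,E(E-1)^{-1}f_i^*+f_iE(E-1)^{-1}\delta f_i^*\big)$. The operator $l$ and its transpose $l^*$ act on $W$ through this expression. Let $$\mu_k=\langle f_k^*,f_k\rangle,\qquad \lambda_k^s=\langle f_k^*,l^sf_k\rangle,\qquad M_k=\{\mu_k=1\}\subset\mathcal P,\qquad M_k^s=\sum_{p=0}^{s-1}(l^pf_k)(E-1)^{-1}\big((l^*)^{s-1-p}f_k^*\big),$$ and consider the squared-eigenfunction flow, for $i=1,\dots,N$, $$\frac{dl}{d\tau_{s,k}}=-[M_k^s,l],\qquad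 \frac{df_i}{d\tau_{s,k}}=(-M_k^s+\delta_k^il^s)f_i,\qquad \frac{df_i^*}{d\tau_{s,k}}=(M_k^s-\delta_k^il^s)^*f_i^*.\tag{F}$$ A gradient of a functional $\gamma$ at a point of $\mathcal P$ is a triple $(r,\chi,\rho)$, with $r$ a formal operator of degree bounded above with bounded coefficients and $\chi,\rho\in W^N$, such that $\delta\gamma=(r,\delta l)+\sum_i(\langle\chi_i,\delta f_i\rangle+\langle\rho_i,\delta f_i^*\rangle)$ for all variations. The Poisson structure is $$\Theta:\ (r,\chi,\rho)\mapsto\Big([l,r_+]-[l,r]_{>0}+\sum_{i}\big(f_iE(E-1)^{-1}\chi_i-\rho_iE(E-1)^{-1}f_i^*\big),\ \ -\rho-r_+\mathrm f,\ \ \chi+r_+^*\mathrm f^*\Big),$$ and the Hamiltonian vector field of $\gamma$ is $-\Theta\nabla\gamma$. Theorem. 1. $M_k$ is invariant under (F). At each point of $M_k$ the right-hand side of (F) is tangent to $\mathcal P$ and annihilated by $d\mu_k$. Every solution of (F) in $\mathcal P$ on an open interval (differentiable coefficientwise in $l$ and in $\ell^2$ in $f_i,f_i^*$) that meets $M_k$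 stays in $M_k$. 2. At each point of $M_k$ the functional $\lambda_k^s$ has a gradient, and for every gradient $\nabla\lambda_k^s$ the right-hand side of (F) equals $-\Theta\nabla\lambda_k^s$. 3. The same holds after reduction to $M_k$. If $G$ represents $\delta\lambda_k^s$ at a point of $M_k$ on the variations with $\delta\mu_k=0$, then the right-hand side of (F) equals $-\Theta(G+c\nabla\mu_k)$ for some $c\in\mathbb C$. Here $\nabla\mu_k$ has $f_k^*$ as $k$-th entry of $\chi$, $f_k$ as $k$-th entry of $\rho$, and all other entries $0$. 4. At points of $M_k$ where $lf_k=\lambda_kf_k$ and $l^*f_k^*=\lambda_kf_k^*$ with $\lambda_k\in\mathbb C$, the functional $\langle f_k^*,l^sf_k\rangle$ takes the value of the power $\lambda_k^s$, and $dl/d\tau_{s,k}=-[M_k^s,l]=-s\lambda_k^{s-1}[M_k^1,l]=s\lambda_k^{s-1}\,dl/d\tau_{1,k}$. 5. At points of $M_k$ where all $f_i,f_i^*$ and all coefficients of $l$ except the leading one are rapidly decreasing, so are the components and coefficients of the right-hand side of (F). -/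

import Mathlib

namespace LatticeLax

/-! ### Sequences on the lattice -/

/-- Complex sequences on the lattice; `(E a) n = a (n + 1)` is the shift. -/
abbrev Seq := ℤ → ℂ

/-- Square summability: membership in `W = ℓ²(ℤ; ℂ)`. -/
def IsL2 (a : Seq) : Prop := Memℓp (E := fun _ : ℤ => ℂ) a 2

/-- Rapidly decreasing sequences. -/
def IsRapid (a : Seq) : Prop :=
  ∀ p : ℕ, ∃ C : ℝ, ∀ n : ℤ, |(n : ℝ)| ^ p * ‖a n‖ ≤ C

/-- The bilinear scalar product `⟨a, b⟩ = ∑ₙ a(n) b(n)`. -/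
noncomputable def dot (a b : Seq) : ℂ := ∑' n, a n * b n

/-- `u` is differentiable at `τ` as a curve in `ℓ²`, with derivative `u'`. -/
def HasL2DerivAt (u : ℝ → Seq) (u' : Seq) (τ : ℝ) : Prop :=
  ∃ (F : ℝ → lp (fun _ : ℤ => ℂ) 2) (F' : lp (fun _ : ℤ => ℂ) 2),
    (∀ᶠ t in nhds τ, (F t : ℤ → ℂ) = u t) ∧ (F' : ℤ → ℂ) = u' ∧ HasDerivAt F F' τ

/-! ### The inverse of `E - 1` on functions -/

/-- Kernel of `(E - 1)⁻¹`. -/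
noncomputable def invKer (n r : ℤ) : ℂ := if r < n then 1 / 2 else -(1 / 2)

/-- `((E - 1)⁻¹ a)(n) = ½ (∑_{r < n} a(r) - ∑_{r ≥ n} a(r))`. It is the inverse of `E - 1` on
summable sequences for which the transpose of `(E - 1)⁻¹` is `(E⁻¹ - 1)⁻¹ = -E (E - 1)⁻¹`. -/
noncomputable def shiftInv (a : Seq) : Seq := fun n => ∑' r, invKer n r * a r

/-- The transpose of `(E - 1)⁻¹`. -/
noncomputable def shiftInvT (a : Seq) : Seq := fun n => ∑' r, invKer r n * a r

/-- `E (E - 1)⁻¹` on functions, with kernel `invKer (n + 1) r`. -/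
noncomputable def shiftShiftInv (a : Seq) : Seq := fun n => ∑' r, invKer (n + 1) r * a r

/-- The transpose of `E (E - 1)⁻¹`. -/
noncomputable def shiftShiftInvT (a : Seq) : Seq := fun n => ∑' r, invKer (r + 1) n * a r

/-- The series defining `shiftInv` converges. -/
theorem summable_invKer_mul {a : Seq} (ha : Summable a) (n : ℤ) :
    Summable fun r => invKer n r * a r := by
  refine Summable.of_norm_bounded ha.norm fun r => ?_
  rw [norm_mul]
  refine mul_le_of_le_one_left (norm_nonneg _) ?_
  unfold invKer
  split_ifs <;> norm_num

/-- `shiftInv` is a right inverse of `E - 1`. -/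
theorem shiftInv_succ_sub {a : Seq} (ha : Summable a) (n : ℤ) :
    shiftInv a (n + 1) - shiftInv a n = a n := by
  unfold shiftInv
  rw [← (summable_invKer_mul ha (n + 1)).tsum_sub (summable_invKer_mul ha n), tsum_eq_single n]
  · simp only [invKer]; norm_num; ring
  · intro r hr
    have : (r < n + 1) ↔ (r < n) := by omega
    simp [invKer, this]

/-- The transpose of `shiftInv` is `-E (E - 1)⁻¹`. -/
theorem shiftInvT_eq (a : Seq) (n : ℤ) : shiftInvT a n = -shiftShiftInv a n := by
  unfold shiftInvT shiftShiftInv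
  rw [← tsum_neg]
  refine tsum_congr fun r => ?_
  by_cases h : n < r
  · have h' : ¬ r < n + 1 := by omega
    simp [invKer, h, h']
  · have h' : r < n + 1 := by omega
    simp [invKer, h, h']

/-! ### Formal shift operators -/

/-- `a : Op` stands for `∑ⱼ aⱼ(n) Eʲ`, with `a j n = aⱼ(n)`. -/
abbrev Op := ℤ → ℤ → ℂ

/-- The product of formal operators given by `Eʲ a = (Eʲ a) Eʲ` (the sum is finite if the degrees
of both factors are bounded above). -/
noncomputable def opMul (a b : Op) : Op := fun j n => ∑ᶠ i, a i n * b (j - i) (n + i)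

noncomputable def opComm (a b : Op) : Op := opMul a b - opMul b a

/-- `A₊`, the part of degree `≥ 0`. -/
noncomputable def opNonneg (a : Op) : Op := fun j => if 0 ≤ j then a j else 0

/-- `A_{>0}`, the part of degree `> 0`. -/
noncomputable def opPos (a : Op) : Op := fun j => if 0 < j then a j else 0

/-- `(A, B) = Tr (A B) = ∑ₙ (A B)₀(n)`. -/
noncomputable def trPair (a b : Op) : ℂ := ∑' n, opMul a b 0 n

/-- Action of `A` on functions, for finitely many nonzero coefficients. -/
noncomputable def opApply (a : Op) (u : Seq) : Seq := fun n => ∑ᶠ j, a j n * u (n + j)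

/-- Action of the transpose `A* = ∑ⱼ E⁻ʲ aⱼ`, for finitely many nonzero coefficients. -/
noncomputable def opApplyT (a : Op) (u : Seq) : Seq := fun n => ∑ᶠ j, a j (n - j) * u (n - j)

/-- `u E (E - 1)⁻¹ v = ∑_{j ≥ 0} u E⁻ʲ v` as a formal operator. -/
noncomputable def sandwich0 (u v : Seq) : Op := fun j n => if j ≤ 0 then u n * v (n + j) else 0

/-- `u (E - 1)⁻¹ v = ∑_{j ≥ 1} u E⁻ʲ v` as a formal operator. -/
noncomputable def sandwich1 (u v : Seq) : Op := fun j n => if j < 0 then u n * v (n + j) else 0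

/-! ### The extended phase space -/

/-- Triples `(l, f, f*)`; also used for tangent vectors `(δl, δf, δf*)` and for gradients
`(δγ/δl, δγ/δf, δγ/δf*)`. -/
abbrev Ext (N : ℕ) := Op × (Fin N → Seq) × (Fin N → Seq)

variable {N : ℕ}

/-- `(l, f, f*)` with `l = E^m + ∑_{j<m} a_j E^j`, summable coefficients `a_j`, `f_i, f_i* ∈ W`, and
`l = l_{>0} + ∑ᵢ f_i E (E - 1)⁻¹ f_i*`. -/
structure IsPhasePoint (m : ℕ) (x : Ext N) : Prop where
  top : ∀ j : ℤ, m < j → x.1 j = 0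
  lead : x.1 m = 1
  coeff : ∀ j : ℤ, j < m → Summable (x.1 j)
  fn : ∀ i, IsL2 (x.2.1 i)
  adj : ∀ i, IsL2 (x.2.2 i)
  shell : ∀ j : ℤ, j ≤ 0 → x.1 j = ∑ i, sandwich0 (x.2.1 i) (x.2.2 i) j

/-- The coordinates `(l_{>0}, f, f*)`. -/
noncomputable def coords (x : Ext N) : Ext N := (opPos x.1, x.2)

/-- The Bäcklund transformation `(l̃, f, f*) ↦ (l̃ + ∑ᵢ f_i E (E - 1)⁻¹ f_i*, f, f*)`. -/
noncomputable def backlund (y : Ext N) : Ext N :=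
  (y.1 + ∑ i, sandwich0 (y.2.1 i) (y.2.2 i), y.2)

/-- Its derivative at `y` in the direction `δ`. -/
noncomputable def backlundDeriv (y δ : Ext N) : Ext N :=
  (δ.1 + ∑ i, (sandwich0 (δ.2.1 i) (y.2.2 i) + sandwich0 (y.2.1 i) (δ.2.2 i)), δ.2)

/-- Admissible variations `(δl_{>0}, δf, δf*)` of the coordinates. -/
structure IsVariation (m : ℕ) (δ : Ext N) : Prop where
  low : ∀ j : ℤ, j ≤ 0 → δ.1 j = 0
  top : ∀ j : ℤ, m ≤ j → δ.1 j = 0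
  coeff : ∀ j : ℤ, Summable (δ.1 j)
  fn : ∀ i, IsL2 (δ.2.1 i)
  adj : ∀ i, IsL2 (δ.2.2 i)

/-- `v` is tangent at `x` to the phase space. -/
def IsTangent (m : ℕ) (x v : Ext N) : Prop :=
  ∃ δ, IsVariation m δ ∧ v = backlundDeriv (coords x) δ

/-- Admissible gradients: the degree is bounded above, the coefficients are bounded, and the other
components are in `W`. -/
structure IsCovector (G : Ext N) : Prop where
  top : ∃ d : ℤ, ∀ j : ℤ, d < j → G.1 j = 0
  coeff : ∀ j : ℤ, ∃ C : ℝ, ∀ n, ‖G.1 j n‖ ≤ C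
  fn : ∀ i, IsL2 (G.2.1 i)
  adj : ∀ i, IsL2 (G.2.2 i)

/-- The pairing of a gradient with a tangent vector. -/
noncomputable def pairing (G v : Ext N) : ℂ :=
  trPair G.1 v.1 + ∑ i, (dot (G.2.1 i) (v.2.1 i) + dot (G.2.2 i) (v.2.2 i))

/-- `δγ = (G, δx)` at `x`, for all variations belonging to `V`. -/
def HasGradientAt (V : Set (Ext N)) (γ : Ext N → ℂ) (x G : Ext N) : Prop :=
  ∀ δ ∈ V, HasDerivAt (fun t : ℂ => γ (backlund (coords x + t • δ)))
    (pairing G (backlundDeriv (coords x) δ)) 0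

/-- The Poisson operator `Θ` at `x`, applied to a gradient `G`. -/
noncomputable def poissonOp (x G : Ext N) : Ext N :=
  (opComm x.1 (opNonneg G.1) - opPos (opComm x.1 G.1)
      + ∑ i, (sandwich0 (x.2.1 i) (G.2.1 i) - sandwich0 (G.2.2 i) (x.2.2 i)),
    fun i => -G.2.2 i - opApply (opNonneg G.1) (x.2.1 i),
    fun i => G.2.1 i + opApplyT (opNonneg G.1) (x.2.2 i))

/-! ### Hamiltonians and squared eigenfunction flows -/

/-- `l u` for `l = l_{>0} + ∑ᵢ f_i E (E - 1)⁻¹ f_i*`. -/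
noncomputable def lApply (x : Ext N) (u : Seq) : Seq :=
  opApply (opPos x.1) u + ∑ i, x.2.1 i * shiftShiftInv (x.2.2 i * u)

/-- `l* u`, the transposed action. -/
noncomputable def lApplyT (x : Ext N) (u : Seq) : Seq :=
  opApplyT (opPos x.1) u + ∑ i, x.2.2 i * shiftShiftInvT (x.2.1 i * u)

/-- `μ_k = ⟨f_k*, f_k⟩`. -/
noncomputable def mu (k : Fin N) (x : Ext N) : ℂ := dot (x.2.2 k) (x.2.1 k)

/-- The differential of `μ_k` at `x`, applied to `v`. -/
noncomputable def muDeriv (k : Fin N) (x v : Ext N) : ℂ :=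
  dot (v.2.2 k) (x.2.1 k) + dot (x.2.2 k) (v.2.1 k)

/-- The gradient of `μ_k`: `f_k*` and `f_k` in the two components with index `k`. -/
noncomputable def muGrad (k : Fin N) (x : Ext N) : Ext N :=
  (0, fun i => if i = k then x.2.2 k else 0, fun i => if i = k then x.2.1 k else 0)

/-- The functional `λ_k^s = ⟨f_k*, l^s f_k⟩`. -/
noncomputable def lam (k : Fin N) (s : ℕ) (x : Ext N) : ℂ :=
  dot (x.2.2 k) ((lApply x)^[s] (x.2.1 k))

/-- The subspace `M_k = {μ_k = 1}` of the phase space. -/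
def subspaceM (m : ℕ) (k : Fin N) : Set (Ext N) := {x | IsPhasePoint m x ∧ mu k x = 1}

/-- `M_k^s = ∑_{p<s} (l^p f_k) (E - 1)⁻¹ ((l*)^{s-1-p} f_k*)` as a formal operator. -/
noncomputable def sqOp (k : Fin N) (s : ℕ) (x : Ext N) : Op :=
  ∑ p ∈ Finset.range s, sandwich1 ((lApply x)^[p] (x.2.1 k)) ((lApplyT x)^[s - 1 - p] (x.2.2 k))

/-- `M_k^s u`. -/
noncomputable def sqApply (k : Fin N) (s : ℕ) (x : Ext N) (u : Seq) : Seq :=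
  ∑ p ∈ Finset.range s,
    (lApply x)^[p] (x.2.1 k) * shiftInv ((lApplyT x)^[s - 1 - p] (x.2.2 k) * u)

/-- `(M_k^s)* u`. -/
noncomputable def sqApplyT (k : Fin N) (s : ℕ) (x : Ext N) (u : Seq) : Seq :=
  ∑ p ∈ Finset.range s,
    (lApplyT x)^[s - 1 - p] (x.2.2 k) * shiftInvT ((lApply x)^[p] (x.2.1 k) * u)

/-- The squared eigenfunction vector field `d/dτ_{s,k}`:
`dl/dτ = -[M_k^s, l]`, `df_i/dτ = (-M_k^s + δ_k^i l^s) f_i`, `df_i*/dτ = (M_k^s - δ_k^i l^s)* f_i*`. -/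
noncomputable def flow (k : Fin N) (s : ℕ) (x : Ext N) : Ext N :=
  (-opComm (sqOp k s x) x.1,
    fun i => -sqApply k s x (x.2.1 i) + if i = k then (lApply x)^[s] (x.2.1 i) else 0,
    fun i => sqApplyT k s x (x.2.2 i) - if i = k then (lApplyT x)^[s] (x.2.2 i) else 0)

/-- `x` is a solution of the flow on `I`: coefficientwise in `l`, in `ℓ²` for the `f_i, f_i*`. -/
def IsSolutionOn (m : ℕ) (k : Fin N) (s : ℕ) (I : Set ℝ) (x : ℝ → Ext N) : Prop :=
  ∀ τ ∈ I, IsPhasePoint m (x τ) ∧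
    (∀ j n, HasDerivAt (fun t => (x t).1 j n) ((flow k s (x τ)).1 j n) τ) ∧
    (∀ i, HasL2DerivAt (fun t => (x t).2.1 i) ((flow k s (x τ)).2.1 i) τ) ∧
    (∀ i, HasL2DerivAt (fun t => (x t).2.2 i) ((flow k s (x τ)).2.2 i) τ)

end LatticeLax

open LatticeLax

namespace LatticeLax

variable {N : ℕ}

/-! ### Bounded, summable and square summable sequences -/

/-! Write `φ_p = l^p f_k`, `ψ_q = (l*)^q f_k*`. The product rule and transposition give `δλ_k^s =
⟨δf_k*, φ_s⟩ + ⟨ψ_s, δf_k⟩ + ∑_p ⟨ψ_{s-1-p}, (δl) φ_p⟩`. The coefficient of `δa_j` is the degree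
`-j` part of `M_k^s`. The symmetric choice of `(E - 1)⁻¹` makes the coefficients of `δf_i` and
`δf_i*` equal to `-df_i*/dτ` and `df_i/dτ`. So `λ_k^s` has the gradient `(M_k^s, -df*/dτ, df/dτ)`
(`hasGradientAt_lamGrad`), whose operator part has no nonnegative degrees.

To match `-Θ` of it with the flow, only `[l, M_k^s]` in degrees `≤ 0` has to be computed. There the
coefficients of the products contain finite sums of `f_i* φ_p` and `f_i ψ_q`, which are differences
of boundary values of `(E - 1)⁻¹`. One boundary value completes `l φ_p` or `l* ψ_q`, the other
yields `M_k^s f_i` or its adjoint. Telescoping in `p` leaves the terms with `l^s`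
(`flow_fst_nonpos`). This is the derivative of `∑ f_i E (E - 1)⁻¹ f_i*` along the flow, which also
gives tangency.

An arbitrary gradient differs from this one only in what no variation detects. Variations see `r` in
degrees strictly between `-m` and `0`, and the sums `χ + r_+* f*`, `ρ + r_+ f`
(`pairing_backlundDeriv`, `eq_of_pairing_eq`); `Θ` depends on nothing else
(`flow_eq_neg_poissonOp`). On `M_k` a gradient of the restriction is first corrected by a multiple
of `∇μ_k`, using a direction on which `dμ_k = 1`.

Conservation of `μ_k` is transposition: the contributions of `M_k^s` and of `l^s` to `df_k` and
`df_k*` cancel in pairs. -/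

def IsBdd (a : Seq) : Prop := ∃ C : ℝ, ∀ n, ‖a n‖ ≤ C

theorem IsBdd.of_summable {a : Seq} (ha : Summable a) : IsBdd a :=
  ⟨∑' n, ‖a n‖, fun n => ha.norm.le_tsum n fun _ _ => norm_nonneg _⟩

theorem IsBdd.shift {a : Seq} (ha : IsBdd a) (j : ℤ) : IsBdd fun n => a (n + j) := by
  obtain ⟨C, hC⟩ := ha
  exact ⟨C, fun n => hC _⟩

theorem IsBdd.neg {a : Seq} (ha : IsBdd a) : IsBdd (-a) := by
  obtain ⟨C, hC⟩ := ha
  exact ⟨C, fun n => by simpa using hC n⟩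

theorem isL2_iff {a : Seq} : IsL2 a ↔ Summable fun n => ‖a n‖ ^ 2 := by
  unfold IsL2
  rw [memℓp_gen_iff (by norm_num)]
  norm_num

theorem isL2_zero : IsL2 0 := zero_memℓp

theorem IsL2.add {a b : Seq} (ha : IsL2 a) (hb : IsL2 b) : IsL2 (a + b) := Memℓp.add ha hb

theorem IsL2.neg {a : Seq} (ha : IsL2 a) : IsL2 (-a) := Memℓp.neg ha

theorem IsL2.sub {a b : Seq} (ha : IsL2 a) (hb : IsL2 b) : IsL2 (a - b) := Memℓp.sub ha hb

theorem IsL2.smul {a : Seq} (ha : IsL2 a) (c : ℂ) : IsL2 (c • a) := Memℓp.const_smul ha c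

theorem IsL2.sum {ι : Type*} {s : Finset ι} {a : ι → Seq} (ha : ∀ i ∈ s, IsL2 (a i)) :
    IsL2 (∑ i ∈ s, a i) := by
  classical
  induction s using Finset.induction_on with
  | empty => simpa using isL2_zero
  | insert i s hi ih =>
    rw [Finset.sum_insert hi]
    exact (ha i (by simp)).add (ih fun j hj => ha j (by simp [hj]))

theorem IsL2.of_norm_le {a b : Seq} {C : ℝ} (ha : IsL2 a) (h : ∀ n, ‖b n‖ ≤ C * ‖a n‖) :
    IsL2 b := by
  rw [isL2_iff] at ha ⊢
  refine Summable.of_nonneg_of_le (fun n => by positivity) (fun n => ?_) (ha.mul_left (C ^ 2))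
  rw [← mul_pow]
  exact pow_le_pow_left₀ (norm_nonneg _) (h n) 2

theorem IsL2.mul_bdd {a b : Seq} (ha : IsL2 a) (hb : IsBdd b) : IsL2 (a * b) := by
  obtain ⟨C, hC⟩ := hb
  refine ha.of_norm_le (C := C) fun n => ?_
  rw [Pi.mul_apply, norm_mul, mul_comm]
  exact mul_le_mul_of_nonneg_right (hC n) (norm_nonneg _)

theorem IsL2.shift {a : Seq} (ha : IsL2 a) (j : ℤ) : IsL2 fun n => a (n + j) := by
  rw [isL2_iff] at ha ⊢
  exact (Equiv.addRight j).summable_iff.mpr ha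

theorem isL2_single (n : ℤ) : IsL2 (Pi.single n 1) := by
  rw [isL2_iff]
  refine summable_of_ne_finset_zero (s := {n}) fun r hr => ?_
  simp only [Finset.mem_singleton] at hr
  simp [Pi.single_eq_of_ne hr]

theorem summable_single (n : ℤ) : Summable (Pi.single n 1 : Seq) := by
  refine summable_of_ne_finset_zero (s := {n}) fun r hr => ?_
  simp only [Finset.mem_singleton] at hr
  simp [Pi.single_eq_of_ne hr]

theorem Summable.mul_isBdd {a b : Seq} (ha : Summable a) (hb : IsBdd b) :
    Summable (a * b) := by
  obtain ⟨C, hC⟩ := hb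
  refine Summable.of_norm_bounded (ha.norm.mul_left C) fun n => ?_
  rw [Pi.mul_apply, norm_mul, mul_comm]
  exact mul_le_mul_of_nonneg_right (hC n) (norm_nonneg _)

theorem Summable.shift {a : Seq} (ha : Summable a) (j : ℤ) : Summable fun n => a (n + j) :=
  (Equiv.addRight j).summable_iff.mpr ha

theorem IsL2.summable_mul {a b : Seq} (ha : IsL2 a) (hb : IsL2 b) : Summable (a * b) := by
  rw [isL2_iff] at ha hb
  refine Summable.of_norm_bounded (ha.add hb) fun n => ?_
  rw [Pi.mul_apply, norm_mul]
  nlinarith [sq_nonneg (‖a n‖ - ‖b n‖), sq_nonneg (‖a n‖), sq_nonneg (‖b n‖)]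

/-! ### The bilinear product -/

theorem dot_comm (a b : Seq) : dot a b = dot b a := by
  simp only [dot, mul_comm]

theorem dot_add_right {a b c : Seq} (ha : IsL2 a) (hb : IsL2 b) (hc : IsL2 c) :
    dot a (b + c) = dot a b + dot a c := by
  unfold dot
  refine Eq.trans (tsum_congr fun n => ?_)
    (Summable.tsum_add (ha.summable_mul hb) (ha.summable_mul hc))
  simp only [Pi.add_apply, mul_add]

theorem dot_add_left {a b c : Seq} (ha : IsL2 a) (hb : IsL2 b) (hc : IsL2 c) :
    dot (b + c) a = dot b a + dot c a := by
  rw [dot_comm, dot_add_right ha hb hc, dot_comm b, dot_comm c]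

theorem dot_smul_right (c : ℂ) (a b : Seq) : dot a (c • b) = c * dot a b := by
  unfold dot
  rw [← tsum_mul_left]
  exact tsum_congr fun n => by simp only [Pi.smul_apply, smul_eq_mul]; ring

theorem dot_smul_left (c : ℂ) (a b : Seq) : dot (c • a) b = c * dot a b := by
  rw [dot_comm, dot_smul_right, dot_comm]

theorem dot_neg_right (a b : Seq) : dot a (-b) = -dot a b := by
  rw [← neg_one_smul ℂ b, dot_smul_right, neg_one_mul]

theorem dot_neg_left (a b : Seq) : dot (-a) b = -dot a b := by
  rw [dot_comm, dot_neg_right, dot_comm]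

theorem dot_sub_left {a b c : Seq} (ha : IsL2 a) (hb : IsL2 b) (hc : IsL2 c) :
    dot (b - c) a = dot b a - dot c a := by
  rw [sub_eq_add_neg, dot_add_left ha hb hc.neg, dot_neg_left, sub_eq_add_neg]

theorem dot_zero_right (a : Seq) : dot a 0 = 0 := by simp [dot]

theorem dot_zero_left (a : Seq) : dot 0 a = 0 := by simp [dot]

theorem dot_sum_right {ι : Type*} {s : Finset ι} {a : Seq} {b : ι → Seq} (ha : IsL2 a)
    (hb : ∀ i ∈ s, IsL2 (b i)) : dot a (∑ i ∈ s, b i) = ∑ i ∈ s, dot a (b i) := by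
  classical
  induction s using Finset.induction_on with
  | empty => simp [dot_zero_right]
  | insert i s hi ih =>
    have hs : ∀ j ∈ s, IsL2 (b j) := fun j hj => hb j (by simp [hj])
    rw [Finset.sum_insert hi, Finset.sum_insert hi,
      dot_add_right ha (hb i (by simp)) (IsL2.sum hs), ih hs]

theorem dot_sum_left {ι : Type*} {s : Finset ι} {a : Seq} {b : ι → Seq} (ha : IsL2 a)
    (hb : ∀ i ∈ s, IsL2 (b i)) : dot (∑ i ∈ s, b i) a = ∑ i ∈ s, dot (b i) a := by
  rw [dot_comm, dot_sum_right ha hb]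
  exact Finset.sum_congr rfl fun i _ => dot_comm _ _

theorem dot_mul_left (a b c : Seq) : dot (a * b) c = dot a (b * c) := by
  simp only [dot, Pi.mul_apply, mul_assoc]

theorem dot_single_right (a : Seq) (n : ℤ) : dot a (Pi.single n 1) = a n := by
  unfold dot
  rw [tsum_eq_single n fun r hr => by simp [Pi.single_eq_of_ne hr]]
  simp

/-- The product `⟨a, b⟩` as a bounded bilinear map on `ℓ²`. -/
theorem exists_bilinear_dot : ∃ B : lp (fun _ : ℤ => ℂ) 2 →L[ℂ] lp (fun _ : ℤ => ℂ) 2 →L[ℂ] ℂ,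
    ∀ a b, B a b = dot a b := by
  refine ⟨LinearMap.mkContinuous₂ (LinearMap.mk₂ ℂ (fun a b => dot a b) ?_ ?_ ?_ ?_) 1 ?_, ?_⟩
  · intro a b c
    exact dot_add_left (lp.memℓp c) (lp.memℓp a) (lp.memℓp b)
  · intro c a b
    exact dot_smul_left c _ _
  · intro a b c
    exact dot_add_right (lp.memℓp a) (lp.memℓp b) (lp.memℓp c)
  · intro c a b
    exact dot_smul_right c _ _
  · intro a b
    have h := lp.tsum_mul_le_mul_norm (p := 2) (q := 2)
      (by simpa using Real.HolderConjugate.two_two) a b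
    rw [one_mul]
    refine le_trans ?_ h.2
    refine (norm_tsum_le_tsum_norm ?_).trans (le_of_eq (tsum_congr fun n => norm_mul _ _))
    simpa only [norm_mul] using h.1
  · intro a b
    rfl

/-! ### The inverse of `E - 1` -/

theorem norm_invKer (n r : ℤ) : ‖invKer n r‖ = 1 / 2 := by
  unfold invKer
  split_ifs <;> norm_num

theorem norm_shiftInv_le {a : Seq} (ha : Summable a) (n : ℤ) :
    ‖shiftInv a n‖ ≤ 1 / 2 * ∑' r, ‖a r‖ := by
  unfold shiftInv
  refine (norm_tsum_le_tsum_norm (summable_invKer_mul ha n).norm).trans (le_of_eq ?_)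
  rw [← tsum_mul_left]
  exact tsum_congr fun r => by rw [norm_mul, norm_invKer]

theorem isBdd_shiftInv {a : Seq} (ha : Summable a) : IsBdd (shiftInv a) :=
  ⟨_, norm_shiftInv_le ha⟩

theorem shiftShiftInv_eq (a : Seq) : shiftShiftInv a = fun n => shiftInv a (n + 1) := rfl

theorem isBdd_shiftShiftInv {a : Seq} (ha : Summable a) : IsBdd (shiftShiftInv a) :=
  (isBdd_shiftInv ha).shift 1

theorem shiftInvT_eq_neg (a : Seq) : shiftInvT a = -shiftShiftInv a :=
  funext fun n => shiftInvT_eq a n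

/-- Since `n < r + 1` is the negation of `r < n`, transposition exchanges the two values of the
kernel. They are opposite only for the symmetric choice `±1/2`; another constant of summation would
leave a multiple of the total sum. -/
theorem shiftShiftInvT_eq_neg (a : Seq) : shiftShiftInvT a = -shiftInv a := by
  funext n
  simp only [shiftShiftInvT, shiftInv, Pi.neg_apply]
  rw [← tsum_neg]
  refine tsum_congr fun r => ?_
  by_cases h : r < n
  · have h' : ¬ n < r + 1 := by omega
    simp [invKer, h, h']
  · have h' : n < r + 1 := by omega
    simp [invKer, h, h']

theorem isBdd_shiftShiftInvT {a : Seq} (ha : Summable a) : IsBdd (shiftShiftInvT a) := by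
  rw [shiftShiftInvT_eq_neg]
  exact (isBdd_shiftInv ha).neg

theorem shiftInv_add {a b : Seq} (ha : Summable a) (hb : Summable b) :
    shiftInv (a + b) = shiftInv a + shiftInv b := by
  funext n
  simp only [shiftInv, Pi.add_apply]
  rw [← (summable_invKer_mul ha n).tsum_add (summable_invKer_mul hb n)]
  simp only [mul_add]

theorem shiftInv_smul (c : ℂ) (a : Seq) : shiftInv (c • a) = c • shiftInv a := by
  funext n
  simp only [shiftInv, Pi.smul_apply, smul_eq_mul]
  rw [← tsum_mul_left]
  exact tsum_congr fun r => by ring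

theorem shiftShiftInv_add {a b : Seq} (ha : Summable a) (hb : Summable b) :
    shiftShiftInv (a + b) = shiftShiftInv a + shiftShiftInv b := by
  simp only [shiftShiftInv_eq, shiftInv_add ha hb]
  rfl

theorem shiftShiftInv_smul (c : ℂ) (a : Seq) : shiftShiftInv (c • a) = c • shiftShiftInv a := by
  simp only [shiftShiftInv_eq, shiftInv_smul]
  rfl

/-- Transposition of `E (E - 1)⁻¹`. -/
theorem dot_shiftShiftInv {a b : Seq} (ha : Summable a) (hb : Summable b) :
    dot a (shiftShiftInv b) = dot (shiftShiftInvT a) b := by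
  simp only [dot, shiftShiftInv, shiftShiftInvT, ← tsum_mul_left, ← tsum_mul_right]
  have h : Summable (Function.uncurry fun n r => a n * (invKer (n + 1) r * b r)) := by
    refine Summable.of_norm_bounded ((ha.norm.mul_of_nonneg hb.norm (fun _ => norm_nonneg _)
      fun _ => norm_nonneg _)) fun p => ?_
    simp only [Function.uncurry, norm_mul, norm_invKer]
    have := mul_nonneg (norm_nonneg (a p.1)) (norm_nonneg (b p.2))
    nlinarith
  refine h.tsum_comm.symm.trans ?_
  exact tsum_congr fun r => tsum_congr fun n => by ring

theorem sum_range_eq_shiftInv_sub {a : Seq} (ha : Summable a) (n : ℤ) (c : ℕ) :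
    ∑ i ∈ Finset.range c, a (n + i) = shiftInv a (n + c) - shiftInv a n := by
  induction c with
  | zero => simp
  | succ c ih =>
    rw [Finset.sum_range_succ, ih, ← shiftInv_succ_sub ha]
    push_cast
    rw [← add_assoc]
    ring

/-- Telescoping; it turns the finite sums in products with formal operators into boundary values of
`(E - 1)⁻¹`. The case `p = q + 1` is the empty sum, needed in degree zero. -/
theorem sum_Icc_eq_shiftInv_sub {a : Seq} (ha : Summable a) (n : ℤ) {p q : ℤ} (h : p ≤ q + 1) :
    ∑ i ∈ Finset.Icc p q, a (n + i) = shiftInv a (n + q + 1) - shiftInv a (n + p) := by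
  obtain ⟨c, hc⟩ := Int.eq_ofNat_of_zero_le (show 0 ≤ q + 1 - p by omega)
  have h1 := sum_range_eq_shiftInv_sub ha (n + p) c
  rw [show n + p + (c : ℤ) = n + q + 1 by omega] at h1
  rw [← h1]
  symm
  refine Finset.sum_bij (fun i _ => p + (i : ℤ)) ?_ ?_ ?_ ?_
  · intro i hi
    simp only [Finset.mem_range, Finset.mem_Icc] at hi ⊢
    omega
  · intro i _ j _ hij
    omega
  · intro i hi
    simp only [Finset.mem_range, Finset.mem_Icc] at hi ⊢
    exact ⟨(i - p).toNat, by omega, by omega⟩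
  · intro i _
    rw [add_assoc]

/-! ### Rapidly decreasing sequences -/

theorem IsRapid.isBdd {a : Seq} (ha : IsRapid a) : IsBdd a := by
  obtain ⟨C, hC⟩ := ha 0
  exact ⟨C, fun n => by simpa using hC n⟩

theorem isRapid_zero : IsRapid 0 := fun p => ⟨0, fun n => by simp⟩

theorem IsRapid.add {a b : Seq} (ha : IsRapid a) (hb : IsRapid b) : IsRapid (a + b) := by
  intro p
  obtain ⟨C, hC⟩ := ha p
  obtain ⟨D, hD⟩ := hb p
  refine ⟨C + D, fun n => ?_⟩
  refine le_trans ?_ (add_le_add (hC n) (hD n))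
  rw [← mul_add]
  exact mul_le_mul_of_nonneg_left (norm_add_le _ _) (by positivity)

theorem IsRapid.neg {a : Seq} (ha : IsRapid a) : IsRapid (-a) := by
  intro p
  obtain ⟨C, hC⟩ := ha p
  exact ⟨C, fun n => by simpa using hC n⟩

theorem IsRapid.sub {a b : Seq} (ha : IsRapid a) (hb : IsRapid b) : IsRapid (a - b) := by
  rw [sub_eq_add_neg]
  exact ha.add hb.neg

theorem IsRapid.sum {ι : Type*} {s : Finset ι} {a : ι → Seq} (ha : ∀ i ∈ s, IsRapid (a i)) :
    IsRapid (∑ i ∈ s, a i) := by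
  classical
  induction s using Finset.induction_on with
  | empty => simpa using isRapid_zero
  | insert i s hi ih =>
    rw [Finset.sum_insert hi]
    exact (ha i (by simp)).add (ih fun j hj => ha j (by simp [hj]))

theorem IsRapid.mul_bdd {a b : Seq} (ha : IsRapid a) (hb : IsBdd b) : IsRapid (a * b) := by
  intro p
  obtain ⟨C, hC⟩ := ha p
  obtain ⟨D, hD⟩ := hb
  refine ⟨C * D, fun n => ?_⟩
  rw [Pi.mul_apply, norm_mul, ← mul_assoc]
  exact mul_le_mul (hC n) (hD n) (norm_nonneg _) ((by positivity : (0:ℝ) ≤ _).trans (hC n))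

theorem IsRapid.shift {a : Seq} (ha : IsRapid a) (j : ℤ) : IsRapid fun n => a (n + j) := by
  intro p
  obtain ⟨C, hC⟩ := ha p
  obtain ⟨D, hD⟩ := ha 0
  -- The constant comes from `(x + y)^p ≤ 2^(p-1) (x^p + y^p)` applied to `|n| ≤ |n + j| + |j|`; `D`
  -- bounds the sequence itself.
  refine ⟨2 ^ (p - 1) * (C + |(j : ℝ)| ^ p * D), fun n => ?_⟩
  have h1 : |(n : ℝ)| ≤ |((n + j : ℤ) : ℝ)| + |(j : ℝ)| := by
    have := abs_sub_abs_le_abs_sub (n : ℝ) (-(j : ℝ))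
    rw [abs_neg, sub_neg_eq_add] at this
    push_cast
    linarith
  have h2 : |(n : ℝ)| ^ p ≤ 2 ^ (p - 1) * (|((n + j : ℤ) : ℝ)| ^ p + |(j : ℝ)| ^ p) :=
    (pow_le_pow_left₀ (abs_nonneg _) h1 p).trans (add_pow_le (abs_nonneg _) (abs_nonneg _) p)
  have h3 := hC (n + j)
  have h4 := hD (n + j)
  rw [pow_zero, one_mul] at h4
  calc |(n : ℝ)| ^ p * ‖a (n + j)‖
      ≤ 2 ^ (p - 1) * (|((n + j : ℤ) : ℝ)| ^ p + |(j : ℝ)| ^ p) * ‖a (n + j)‖ :=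
        mul_le_mul_of_nonneg_right h2 (norm_nonneg _)
    _ = 2 ^ (p - 1) * (|((n + j : ℤ) : ℝ)| ^ p * ‖a (n + j)‖ + |(j : ℝ)| ^ p * ‖a (n + j)‖) := by
        ring
    _ ≤ _ := by gcongr

/-! ### Formal operators -/

theorem sum_Icc_split (F : ℤ → ℂ) {p q r : ℤ} (h : p ≤ q + 1) (h' : q ≤ r) :
    ∑ i ∈ Finset.Icc p r, F i = ∑ i ∈ Finset.Icc p q, F i + ∑ i ∈ Finset.Icc (q + 1) r, F i := by
  rw [← Finset.sum_union]
  · congr 1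
    ext i
    simp only [Finset.mem_union, Finset.mem_Icc]
    omega
  · rw [Finset.disjoint_left]
    intro i hi hi'
    simp only [Finset.mem_Icc] at hi hi'
    omega

/-- Reindexes a product by the degree of its right factor, which is how `opApplyT` sums. -/
theorem sum_Icc_reflect (F : ℤ → ℂ) (j p q : ℤ) :
    ∑ i ∈ Finset.Icc p q, F i = ∑ c ∈ Finset.Icc (j - q) (j - p), F (j - c) := by
  refine Finset.sum_nbij' (fun i => j - i) (fun c => j - c) ?_ ?_ ?_ ?_ ?_
  · intro i hi
    simp only [Finset.mem_Icc] at hi ⊢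
    omega
  · intro i hi
    simp only [Finset.mem_Icc] at hi ⊢
    omega
  · intro i _
    omega
  · intro i _
    omega
  · intro i _
    rw [sub_sub_cancel]

theorem opMul_eq_sum_of {a b : Op} {j n : ℤ} {S : Finset ℤ}
    (h : ∀ i ∉ S, a i n * b (j - i) (n + i) = 0) :
    opMul a b j n = ∑ i ∈ S, a i n * b (j - i) (n + i) := by
  unfold opMul
  refine finsum_eq_sum_of_support_subset _ fun i hi => ?_
  by_contra hS
  exact hi (h i hS)

/-- A `finsum` over an infinite support is `0` by default, so algebraic identities for products go
through such finite forms. The left factor forces `i ≤ d`, the right one `j - i ≤ e`. -/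
theorem opMul_eq_sum {a b : Op} {d e : ℤ} (ha : ∀ i, d < i → a i = 0)
    (hb : ∀ i, e < i → b i = 0) (j n : ℤ) :
    opMul a b j n = ∑ i ∈ Finset.Icc (j - e) d, a i n * b (j - i) (n + i) := by
  refine opMul_eq_sum_of fun i hi => ?_
  rw [Finset.mem_Icc, not_and_or] at hi
  rcases hi with hi | hi
  · rw [hb (j - i) (by omega)]
    simp
  · rw [ha i (by omega)]
    simp

theorem opMul_add_right {a b c : Op} {d e : ℤ} (ha : ∀ i, d < i → a i = 0)
    (hb : ∀ i, e < i → b i = 0) (hc : ∀ i, e < i → c i = 0) :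
    opMul a (b + c) = opMul a b + opMul a c := by
  have hbc : ∀ i, e < i → (b + c) i = 0 := fun i hi => by simp [hb i hi, hc i hi]
  funext j n
  simp only [Pi.add_apply, opMul_eq_sum ha hb, opMul_eq_sum ha hc, opMul_eq_sum ha hbc,
    mul_add, Finset.sum_add_distrib]

theorem opComm_add_left {a b c : Op} {d e : ℤ} (ha : ∀ i, d < i → a i = 0)
    (hb : ∀ i, d < i → b i = 0) (hc : ∀ i, e < i → c i = 0) :
    opComm (a + b) c = opComm a c + opComm b c := by
  have hab : ∀ i, d < i → (a + b) i = 0 := fun i hi => by simp [ha i hi, hb i hi]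
  funext j n
  simp only [opComm, Pi.add_apply, Pi.sub_apply, opMul_eq_sum ha hc, opMul_eq_sum hb hc,
    opMul_eq_sum hab hc, opMul_eq_sum hc ha, opMul_eq_sum hc hb, opMul_eq_sum hc hab,
    mul_add, add_mul, Finset.sum_add_distrib]
  ring

theorem opComm_smul_left (c : ℂ) {a b : Op} {d e : ℤ} (ha : ∀ i, d < i → a i = 0)
    (hb : ∀ i, e < i → b i = 0) : opComm (c • a) b = c • opComm a b := by
  have hca : ∀ i, d < i → (c • a) i = 0 := fun i hi => by simp [ha i hi]
  funext j n
  simp only [opComm, Pi.smul_apply, Pi.sub_apply, opMul_eq_sum ha hb, opMul_eq_sum hca hb,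
    opMul_eq_sum hb ha, opMul_eq_sum hb hca, smul_eq_mul, mul_sub, Finset.mul_sum]
  congr 1 <;> exact Finset.sum_congr rfl fun i _ => by ring

theorem opComm_sum_left {ι : Type*} (S : Finset ι) {a : ι → Op} {b : Op} {d e : ℤ}
    (ha : ∀ p ∈ S, ∀ i, d < i → a p i = 0) (hb : ∀ i, e < i → b i = 0) :
    opComm (∑ p ∈ S, a p) b = ∑ p ∈ S, opComm (a p) b := by
  classical
  induction S using Finset.induction_on with
  | empty =>
    funext j n
    simp [opComm, opMul]
  | insert p S hp ih =>
    have hS : ∀ q ∈ S, ∀ i, d < i → a q i = 0 := fun q hq => ha q (by simp [hq])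
    rw [Finset.sum_insert hp, Finset.sum_insert hp, ← ih hS]
    refine opComm_add_left (ha p (by simp)) (fun i hi => ?_) hb
    rw [Finset.sum_apply]
    exact Finset.sum_eq_zero fun q hq => hS q hq i hi

theorem opComm_swap (a b : Op) : -opComm a b = opComm b a := by
  simp [opComm]

theorem opApply_eq_sum {a : Op} {S : Finset ℤ} (h : ∀ j ∉ S, a j = 0) (u : Seq) (n : ℤ) :
    opApply a u n = ∑ j ∈ S, a j n * u (n + j) := by
  unfold opApply
  refine finsum_eq_sum_of_support_subset _ fun i hi => ?_
  by_contra hS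
  exact hi (by simp [h i hS])

theorem opApplyT_eq_sum {a : Op} {S : Finset ℤ} (h : ∀ j ∉ S, a j = 0) (u : Seq) (n : ℤ) :
    opApplyT a u n = ∑ j ∈ S, a j (n - j) * u (n - j) := by
  unfold opApplyT
  refine finsum_eq_sum_of_support_subset _ fun i hi => ?_
  by_contra hS
  exact hi (by simp [h i hS])

theorem opApply_eq_sum' {a : Op} {S : Finset ℤ} (h : ∀ j ∉ S, a j = 0) (u : Seq) :
    opApply a u = ∑ j ∈ S, (fun n => u (n + j)) * a j := by
  funext n
  rw [opApply_eq_sum h, Finset.sum_apply]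
  exact Finset.sum_congr rfl fun j _ => mul_comm _ _

theorem opApplyT_eq_sum' {a : Op} {S : Finset ℤ} (h : ∀ j ∉ S, a j = 0) (u : Seq) :
    opApplyT a u = ∑ j ∈ S, (fun n => u (n + -j)) * fun n => a j (n + -j) := by
  funext n
  rw [opApplyT_eq_sum h, Finset.sum_apply]
  exact Finset.sum_congr rfl fun j _ => mul_comm _ _

theorem isL2_opApply {a : Op} {S : Finset ℤ} (h : ∀ j ∉ S, a j = 0) (hb : ∀ j, IsBdd (a j))
    {u : Seq} (hu : IsL2 u) : IsL2 (opApply a u) := by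
  rw [opApply_eq_sum' h]
  exact IsL2.sum fun j _ => (hu.shift j).mul_bdd (hb j)

theorem isL2_opApplyT {a : Op} {S : Finset ℤ} (h : ∀ j ∉ S, a j = 0) (hb : ∀ j, IsBdd (a j))
    {u : Seq} (hu : IsL2 u) : IsL2 (opApplyT a u) := by
  rw [opApplyT_eq_sum' h]
  exact IsL2.sum fun j _ => (hu.shift (-j)).mul_bdd ((hb j).shift (-j))

theorem dot_shift (a b : Seq) (j : ℤ) :
    dot (fun n => a (n + j)) (fun n => b (n + j)) = dot a b :=
  (Equiv.addRight j).tsum_eq fun n => a n * b n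

/-- `opApplyT` is the transpose of `opApply`. -/
theorem dot_opApply {a : Op} {S : Finset ℤ} (h : ∀ j ∉ S, a j = 0) (hb : ∀ j, IsBdd (a j))
    {u v : Seq} (hu : IsL2 u) (hv : IsL2 v) : dot u (opApply a v) = dot (opApplyT a u) v := by
  rw [opApply_eq_sum' h, opApplyT_eq_sum' h,
    dot_sum_right hu fun j _ => (hv.shift j).mul_bdd (hb j),
    dot_sum_left hv fun j _ => (hu.shift (-j)).mul_bdd ((hb j).shift (-j))]
  refine Finset.sum_congr rfl fun j _ => ?_
  rw [← dot_shift ((fun n => u (n + -j)) * fun n => a j (n + -j)) v j]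
  simp only [dot, Pi.mul_apply, add_neg_cancel_right]
  exact tsum_congr fun n => by ring

theorem opApply_smul {a : Op} {S : Finset ℤ} (h : ∀ j ∉ S, a j = 0) (c : ℂ) (u : Seq) :
    opApply a (c • u) = c • opApply a u := by
  funext n
  rw [Pi.smul_apply, opApply_eq_sum h, opApply_eq_sum h, Finset.smul_sum]
  exact Finset.sum_congr rfl fun j _ => by simp only [Pi.smul_apply, smul_eq_mul]; ring

theorem opApply_add {a b : Op} {S : Finset ℤ} (ha : ∀ j ∉ S, a j = 0) (hb : ∀ j ∉ S, b j = 0)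
    (u : Seq) : opApply (a + b) u = opApply a u + opApply b u := by
  have hab : ∀ j ∉ S, (a + b) j = 0 := fun j hj => by simp [ha j hj, hb j hj]
  funext n
  simp only [Pi.add_apply, opApply_eq_sum ha, opApply_eq_sum hb, opApply_eq_sum hab, add_mul,
    Finset.sum_add_distrib]

theorem opApply_smul_left (c : ℂ) {a : Op} {S : Finset ℤ} (ha : ∀ j ∉ S, a j = 0) (u : Seq) :
    opApply (c • a) u = c • opApply a u := by
  have hca : ∀ j ∉ S, (c • a) j = 0 := fun j hj => by simp [ha j hj]
  funext n
  simp only [Pi.smul_apply, opApply_eq_sum ha, opApply_eq_sum hca, Finset.mul_sum, smul_eq_mul,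
    mul_assoc]

theorem sandwich0_of_nonpos {j : ℤ} (hj : j ≤ 0) (u v : Seq) (n : ℤ) :
    sandwich0 u v j n = u n * v (n + j) := if_pos hj

theorem sandwich0_of_pos {j : ℤ} (hj : 0 < j) (u v : Seq) : sandwich0 u v j = 0 :=
  funext fun _ => if_neg (by omega)

theorem sandwich1_of_neg {j : ℤ} (hj : j < 0) (u v : Seq) (n : ℤ) :
    sandwich1 u v j n = u n * v (n + j) := if_pos hj

theorem sandwich1_of_nonneg {j : ℤ} (hj : 0 ≤ j) (u v : Seq) : sandwich1 u v j = 0 :=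
  funext fun _ => if_neg (by omega)

theorem opNonneg_eq_zero {a : Op} {d : ℤ} (ha : ∀ j, d < j → a j = 0) :
    ∀ j ∉ Finset.Icc 0 d, opNonneg a j = 0 := by
  intro j hj
  rw [Finset.mem_Icc, not_and_or] at hj
  unfold opNonneg
  split_ifs with h
  · exact ha j (by omega)
  · rfl

theorem isBdd_opNonneg {a : Op} (ha : ∀ j, IsBdd (a j)) (j : ℤ) : IsBdd (opNonneg a j) := by
  unfold opNonneg
  split_ifs
  · exact ha j
  · exact ⟨0, fun n => by simp⟩

/-! ### The operator `l` on `ℓ²` -/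

theorem IsPhasePoint.isBdd {m : ℕ} {x : Ext N} (hx : IsPhasePoint m x) (j : ℤ) :
    IsBdd (x.1 j) := by
  rcases lt_trichotomy j m with h | h | h
  · exact .of_summable (hx.coeff j h)
  · rw [h, hx.lead]
    exact ⟨1, fun n => by simp⟩
  · rw [hx.top j h]
    exact ⟨0, fun n => by simp⟩

theorem IsPhasePoint.opPos_eq_zero {m : ℕ} {x : Ext N} (hx : IsPhasePoint m x) :
    ∀ j ∉ Finset.Icc 1 (m : ℤ), opPos x.1 j = 0 := by
  intro j hj
  rw [Finset.mem_Icc, not_and_or] at hj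
  unfold opPos
  split_ifs with h
  · exact hx.top j (by omega)
  · rfl

theorem IsPhasePoint.isBdd_opPos {m : ℕ} {x : Ext N} (hx : IsPhasePoint m x) (j : ℤ) :
    IsBdd (opPos x.1 j) := by
  unfold opPos
  split_ifs
  · exact hx.isBdd j
  · exact ⟨0, fun n => by simp⟩

/-- The product `f_i* u` of two `ℓ²` sequences is summable, so its image under `E (E - 1)⁻¹` is
bounded, and the prefactor `f_i` restores square summability. -/
theorem IsPhasePoint.isL2_lApply {m : ℕ} {x : Ext N} (hx : IsPhasePoint m x) {u : Seq}
    (hu : IsL2 u) : IsL2 (lApply x u) :=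
  (isL2_opApply hx.opPos_eq_zero hx.isBdd_opPos hu).add <| IsL2.sum fun i _ =>
    (hx.fn i).mul_bdd (isBdd_shiftShiftInv ((hx.adj i).summable_mul hu))

theorem IsPhasePoint.isL2_lApplyT {m : ℕ} {x : Ext N} (hx : IsPhasePoint m x) {u : Seq}
    (hu : IsL2 u) : IsL2 (lApplyT x u) :=
  (isL2_opApplyT hx.opPos_eq_zero hx.isBdd_opPos hu).add <| IsL2.sum fun i _ =>
    (hx.adj i).mul_bdd (isBdd_shiftShiftInvT ((hx.fn i).summable_mul hu))

theorem IsPhasePoint.isL2_iterate {m : ℕ} {x : Ext N} (hx : IsPhasePoint m x) {u : Seq}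
    (hu : IsL2 u) (p : ℕ) : IsL2 ((lApply x)^[p] u) := by
  induction p with
  | zero => exact hu
  | succ p ih =>
    rw [Function.iterate_succ_apply']
    exact hx.isL2_lApply ih

theorem IsPhasePoint.isL2_iterateT {m : ℕ} {x : Ext N} (hx : IsPhasePoint m x) {u : Seq}
    (hu : IsL2 u) (p : ℕ) : IsL2 ((lApplyT x)^[p] u) := by
  induction p with
  | zero => exact hu
  | succ p ih =>
    rw [Function.iterate_succ_apply']
    exact hx.isL2_lApplyT ih

/-- Transposition of `u E (E - 1)⁻¹ v`. -/
theorem dot_mul_shiftShiftInv {u v f g : Seq} (hu : IsL2 u) (hv : IsL2 v) (hf : IsL2 f)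
    (hg : IsL2 g) :
    dot u (f * shiftShiftInv (g * v)) = dot (g * shiftShiftInvT (f * u)) v := by
  rw [← dot_mul_left, dot_shiftShiftInv (hu.summable_mul hf) (hg.summable_mul hv),
    ← dot_mul_left, mul_comm u f, mul_comm g]

theorem IsPhasePoint.dot_lApply {m : ℕ} {x : Ext N} (hx : IsPhasePoint m x) {u v : Seq}
    (hu : IsL2 u) (hv : IsL2 v) : dot u (lApply x v) = dot (lApplyT x u) v := by
  have h1 : ∀ i ∈ Finset.univ, IsL2 (x.2.1 i * shiftShiftInv (x.2.2 i * v)) := fun i _ =>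
    (hx.fn i).mul_bdd (isBdd_shiftShiftInv ((hx.adj i).summable_mul hv))
  have h2 : ∀ i ∈ Finset.univ, IsL2 (x.2.2 i * shiftShiftInvT (x.2.1 i * u)) := fun i _ =>
    (hx.adj i).mul_bdd (isBdd_shiftShiftInvT ((hx.fn i).summable_mul hu))
  unfold lApply lApplyT
  rw [dot_add_right hu (isL2_opApply hx.opPos_eq_zero hx.isBdd_opPos hv) (IsL2.sum h1),
    dot_add_left hv (isL2_opApplyT hx.opPos_eq_zero hx.isBdd_opPos hu) (IsL2.sum h2),
    dot_opApply hx.opPos_eq_zero hx.isBdd_opPos hu hv, dot_sum_right hu h1, dot_sum_left hv h2]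
  congr 1
  exact Finset.sum_congr rfl fun i _ => dot_mul_shiftShiftInv hu hv (hx.fn i) (hx.adj i)

theorem IsPhasePoint.dot_iterate {m : ℕ} {x : Ext N} (hx : IsPhasePoint m x) {u v : Seq}
    (hu : IsL2 u) (hv : IsL2 v) (p : ℕ) :
    dot u ((lApply x)^[p] v) = dot ((lApplyT x)^[p] u) v := by
  induction p generalizing u with
  | zero => rfl
  | succ p ih =>
    rw [Function.iterate_succ_apply', Function.iterate_succ_apply,
      hx.dot_lApply hu (hx.isL2_iterate hv p), ih (hx.isL2_lApplyT hu)]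

/-! ### Commutators with `l` -/

/-- Positive degrees of `l` give `l_{>0} φ`. Degrees `j + 1, …, 0` give finite sums of `f_i* φ`,
hence differences of `E (E - 1)⁻¹ (f_i* φ)` at `n` and `n + j`; the value at `n` completes `l φ`,
the value at `n + j` is the correction. -/
theorem IsPhasePoint.opMul_sandwich1 {m : ℕ} {x : Ext N} (hx : IsPhasePoint m x) {φ ψ : Seq}
    (hφ : IsL2 φ) {j : ℤ} (hj : j ≤ 0) (n : ℤ) :
    opMul x.1 (sandwich1 φ ψ) j n = lApply x φ n * ψ (n + j)
      - ∑ i, x.2.1 i n * (shiftShiftInv (x.2.2 i * φ) (n + j) * ψ (n + j)) := by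
  rw [opMul_eq_sum (d := m) (e := -1) hx.top
      (fun i hi => sandwich1_of_nonneg (by omega) _ _),
    sum_Icc_split _ (q := 0) (by omega) (by omega)]
  have h1 : ∑ i ∈ Finset.Icc (0 + 1) (m : ℤ), x.1 i n * sandwich1 φ ψ (j - i) (n + i)
      = opApply (opPos x.1) φ n * ψ (n + j) := by
    rw [opApply_eq_sum hx.opPos_eq_zero, Finset.sum_mul]
    refine Finset.sum_congr rfl fun i hi => ?_
    rw [Finset.mem_Icc] at hi
    rw [sandwich1_of_neg (by omega), opPos, if_pos (by omega), show n + i + (j - i) = n + j by ring]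
    ring
  have h2 : ∑ i ∈ Finset.Icc (j - -1) 0, x.1 i n * sandwich1 φ ψ (j - i) (n + i)
      = ∑ k, x.2.1 k n * (shiftShiftInv (x.2.2 k * φ) n
          - shiftShiftInv (x.2.2 k * φ) (n + j)) * ψ (n + j) := by
    have h3 : ∀ i ∈ Finset.Icc (j - -1) 0, x.1 i n * sandwich1 φ ψ (j - i) (n + i)
        = ∑ k, x.2.1 k n * (x.2.2 k * φ) (n + i) * ψ (n + j) := by
      intro i hi
      rw [Finset.mem_Icc] at hi
      rw [hx.shell i hi.2, Finset.sum_apply, Finset.sum_mul]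
      refine Finset.sum_congr rfl fun k _ => ?_
      rw [sandwich1_of_neg (by omega), sandwich0_of_nonpos hi.2,
        show n + i + (j - i) = n + j by ring, Pi.mul_apply]
      ring
    rw [Finset.sum_congr rfl h3, Finset.sum_comm]
    refine Finset.sum_congr rfl fun k _ => ?_
    rw [← Finset.sum_mul, ← Finset.mul_sum,
      sum_Icc_eq_shiftInv_sub ((hx.adj k).summable_mul hφ) n (by omega)]
    simp only [shiftShiftInv_eq]
    rw [show n + 0 + 1 = n + 1 by ring, show n + (j - -1) = n + j + 1 by ring]
  rw [h1, h2]
  simp only [lApply, Pi.add_apply, Finset.sum_apply, Pi.mul_apply, add_mul, Finset.sum_mul]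
  rw [add_sub_assoc, ← Finset.sum_sub_distrib, add_comm]
  congr 1
  exact Finset.sum_congr rfl fun k _ => by ring

/-- Mirror image of `opMul_sandwich1`: now the boundary value at `n + j` completes `l* ψ`, because
the transpose of `E (E - 1)⁻¹` is `-(E - 1)⁻¹`, and the value at `n` is the correction. -/
theorem IsPhasePoint.sandwich1_opMul {m : ℕ} {x : Ext N} (hx : IsPhasePoint m x) {φ ψ : Seq}
    (hψ : IsL2 ψ) {j : ℤ} (hj : j ≤ 0) (n : ℤ) :
    opMul (sandwich1 φ ψ) x.1 j n = φ n * lApplyT x ψ (n + j)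
      + ∑ i, φ n * shiftInv (x.2.1 i * ψ) n * x.2.2 i (n + j) := by
  rw [opMul_eq_sum (d := -1) (e := m)
      (fun i hi => sandwich1_of_nonneg (by omega) _ _) hx.top,
    sum_Icc_split _ (q := j - 1) (by omega) (by omega)]
  have h1 : ∑ i ∈ Finset.Icc (j - m) (j - 1), sandwich1 φ ψ i n * x.1 (j - i) (n + i)
      = φ n * opApplyT (opPos x.1) ψ (n + j) := by
    rw [opApplyT_eq_sum hx.opPos_eq_zero, Finset.mul_sum, sum_Icc_reflect _ j]
    rw [sub_sub_cancel, sub_sub_cancel]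
    refine Finset.sum_congr rfl fun i hi => ?_
    rw [Finset.mem_Icc] at hi
    rw [sandwich1_of_neg (by omega), opPos, if_pos (by omega), sub_sub_cancel,
      show n + (j - i) = n + j - i by ring]
    ring
  have h2 : ∑ i ∈ Finset.Icc (j - 1 + 1) (-1), sandwich1 φ ψ i n * x.1 (j - i) (n + i)
      = ∑ k, φ n * (shiftInv (x.2.1 k * ψ) n - shiftInv (x.2.1 k * ψ) (n + j))
          * x.2.2 k (n + j) := by
    have h3 : ∀ i ∈ Finset.Icc (j - 1 + 1) (-1), sandwich1 φ ψ i n * x.1 (j - i) (n + i)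
        = ∑ k, φ n * (x.2.1 k * ψ) (n + i) * x.2.2 k (n + j) := by
      intro i hi
      rw [Finset.mem_Icc] at hi
      rw [hx.shell (j - i) (by omega), Finset.sum_apply, Finset.mul_sum]
      refine Finset.sum_congr rfl fun k _ => ?_
      rw [sandwich1_of_neg (by omega), sandwich0_of_nonpos (by omega),
        show n + i + (j - i) = n + j by ring, Pi.mul_apply]
      ring
    rw [Finset.sum_congr rfl h3, Finset.sum_comm]
    refine Finset.sum_congr rfl fun k _ => ?_
    rw [← Finset.sum_mul, ← Finset.mul_sum,
      sum_Icc_eq_shiftInv_sub ((hx.fn k).summable_mul hψ) n (by omega)]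
    rw [show n + -1 + 1 = n by ring, show n + (j - 1 + 1) = n + j by ring]
  rw [h1, h2]
  simp only [lApplyT, shiftShiftInvT_eq_neg, Pi.add_apply, Finset.sum_apply, Pi.mul_apply,
    Pi.neg_apply, mul_add, Finset.mul_sum]
  rw [add_assoc, ← Finset.sum_add_distrib]
  congr 1
  exact Finset.sum_congr rfl fun k _ => by ring

/-- `[l, φ (E - 1)⁻¹ ψ]` in degrees `≤ 0`. -/
theorem IsPhasePoint.opComm_sandwich1 {m : ℕ} {x : Ext N} (hx : IsPhasePoint m x) {φ ψ : Seq}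
    (hφ : IsL2 φ) (hψ : IsL2 ψ) {j : ℤ} (hj : j ≤ 0) (n : ℤ) :
    opComm x.1 (sandwich1 φ ψ) j n =
      lApply x φ n * ψ (n + j) - φ n * lApplyT x ψ (n + j)
      - ∑ i, (x.2.1 i n * (shiftShiftInv (x.2.2 i * φ) (n + j) * ψ (n + j))
          + φ n * shiftInv (x.2.1 i * ψ) n * x.2.2 i (n + j)) := by
  rw [opComm, Pi.sub_apply, Pi.sub_apply, hx.opMul_sandwich1 hφ hj, hx.sandwich1_opMul hψ hj,
    Finset.sum_add_distrib]
  ring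

/-- `[l, B]` in degrees `≤ 0`, for `B` without negative powers of `E`. -/
theorem IsPhasePoint.opComm_of_nonneg {m : ℕ} {x : Ext N} (hx : IsPhasePoint m x) {b : Op} {d : ℤ}
    (hb : ∀ j ∉ Finset.Icc 0 d, b j = 0) {j : ℤ} (hj : j ≤ 0) (n : ℤ) :
    opComm x.1 b j n = ∑ i, (x.2.1 i n * opApplyT b (x.2.2 i) (n + j)
      - opApply b (x.2.1 i) n * x.2.2 i (n + j)) := by
  -- In total degree `≤ 0`, a factor of degree `≥ 0` meets only the degrees `≤ 0` of `l`, where `l`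
  -- is its sandwich part.
  have h1 : opMul x.1 b j n = ∑ k, x.2.1 k n * opApplyT b (x.2.2 k) (n + j) := by
    rw [opMul_eq_sum_of (S := Finset.Icc (j - d) (j - 0)), sum_Icc_reflect _ j]
    · rw [sub_sub_cancel, sub_sub_cancel]
      simp only [opApplyT_eq_sum hb, Finset.mul_sum]
      rw [Finset.sum_comm]
      refine Finset.sum_congr rfl fun i hi => ?_
      rw [Finset.mem_Icc] at hi
      rw [hx.shell (j - i) (by omega), Finset.sum_apply, Finset.sum_mul]
      refine Finset.sum_congr rfl fun k _ => ?_
      rw [sandwich0_of_nonpos (by omega), sub_sub_cancel, show n + (j - i) = n + j - i by ring]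
      ring
    · intro i hi
      rw [hb (j - i) (by rw [Finset.mem_Icc] at hi ⊢; omega)]
      simp
  have h2 : opMul b x.1 j n = ∑ k, opApply b (x.2.1 k) n * x.2.2 k (n + j) := by
    rw [opMul_eq_sum_of (S := Finset.Icc 0 d)]
    · simp only [opApply_eq_sum hb, Finset.sum_mul]
      rw [Finset.sum_comm]
      refine Finset.sum_congr rfl fun i hi => ?_
      rw [Finset.mem_Icc] at hi
      rw [hx.shell (j - i) (by omega), Finset.sum_apply, Finset.mul_sum]
      refine Finset.sum_congr rfl fun k _ => ?_
      rw [sandwich0_of_nonpos (by omega), show n + i + (j - i) = n + j by ring]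
      ring
    · intro i hi
      rw [hb i hi]
      simp
  rw [opComm, Pi.sub_apply, Pi.sub_apply, h1, h2, Finset.sum_sub_distrib]

/-! ### The vector field -/

theorem sqOp_of_nonneg (k : Fin N) (s : ℕ) (x : Ext N) {j : ℤ} (hj : 0 ≤ j) :
    sqOp k s x j = 0 := by
  rw [sqOp, Finset.sum_apply]
  exact Finset.sum_eq_zero fun p _ => sandwich1_of_nonneg hj _ _

theorem sqOp_of_neg (k : Fin N) (s : ℕ) (x : Ext N) {j : ℤ} (hj : j < 0) :
    sqOp k s x j = ∑ p ∈ Finset.range s, (lApply x)^[p] (x.2.1 k) *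
      fun n => (lApplyT x)^[s - 1 - p] (x.2.2 k) (n + j) := by
  rw [sqOp, Finset.sum_apply]
  exact Finset.sum_congr rfl fun p _ => funext fun n => sandwich1_of_neg hj _ _ n

theorem IsPhasePoint.summable_sqOp {m : ℕ} {x : Ext N} (hx : IsPhasePoint m x) (k : Fin N)
    (s : ℕ) (j : ℤ) : Summable (sqOp k s x j) := by
  rcases lt_or_ge j 0 with hj | hj
  · rw [sqOp_of_neg k s x hj]
    have : ∀ p ∈ Finset.range s, Summable ((lApply x)^[p] (x.2.1 k) *
        fun n => (lApplyT x)^[s - 1 - p] (x.2.2 k) (n + j)) := fun p _ =>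
      (hx.isL2_iterate (hx.fn k) p).summable_mul ((hx.isL2_iterateT (hx.adj k) _).shift j)
    convert summable_sum this with n
    rw [Finset.sum_apply]
  · rw [sqOp_of_nonneg k s x hj]
    exact summable_zero

theorem IsPhasePoint.isL2_flow_fn {m : ℕ} {x : Ext N} (hx : IsPhasePoint m x) (k : Fin N)
    (s : ℕ) (i : Fin N) : IsL2 ((flow k s x).2.1 i) := by
  refine (IsL2.neg (IsL2.sum fun p _ => (hx.isL2_iterate (hx.fn k) p).mul_bdd (isBdd_shiftInv
    ((hx.isL2_iterateT (hx.adj k) _).summable_mul (hx.fn i))))).add ?_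
  split_ifs
  · exact hx.isL2_iterate (hx.fn i) s
  · exact isL2_zero

theorem IsPhasePoint.isL2_flow_adj {m : ℕ} {x : Ext N} (hx : IsPhasePoint m x) (k : Fin N)
    (s : ℕ) (i : Fin N) : IsL2 ((flow k s x).2.2 i) := by
  refine (IsL2.sum fun p _ => (hx.isL2_iterateT (hx.adj k) _).mul_bdd ?_).sub ?_
  · rw [shiftInvT_eq_neg]
    exact (isBdd_shiftShiftInv ((hx.isL2_iterate (hx.fn k) p).summable_mul (hx.adj i))).neg
  · split_ifs
    · exact hx.isL2_iterateT (hx.adj i) s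
    · exact isL2_zero

theorem flow_fst (k : Fin N) (s : ℕ) (x : Ext N) :
    (flow k s x).1 = opComm x.1 (sqOp k s x) := opComm_swap _ _

/-- The vector field in degrees `≤ 0`. -/
theorem IsPhasePoint.flow_fst_nonpos {m : ℕ} {x : Ext N} (hx : IsPhasePoint m x) (k : Fin N)
    (s : ℕ) {j : ℤ} (hj : j ≤ 0) (n : ℤ) :
    (flow k s x).1 j n = ∑ i, ((flow k s x).2.1 i n * x.2.2 i (n + j)
      + x.2.1 i n * (flow k s x).2.2 i (n + j)) := by
  set φ : ℕ → Seq := fun p => (lApply x)^[p] (x.2.1 k) with hφ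
  set ψ : ℕ → Seq := fun p => (lApplyT x)^[p] (x.2.2 k) with hψ
  have hφ2 : ∀ p, IsL2 (φ p) := hx.isL2_iterate (hx.fn k)
  have hψ2 : ∀ p, IsL2 (ψ p) := hx.isL2_iterateT (hx.adj k)
  have h1 : (flow k s x).1 j n = ∑ p ∈ Finset.range s,
      opComm x.1 (sandwich1 (φ p) (ψ (s - 1 - p))) j n := by
    rw [flow_fst, ← opComm_swap]
    unfold sqOp
    rw [opComm_sum_left (d := -1) _ (fun p _ i hi => sandwich1_of_nonneg (by omega) _ _) hx.top,
      ← Finset.sum_neg_distrib, Finset.sum_apply, Finset.sum_apply]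
    exact Finset.sum_congr rfl fun p _ => by rw [opComm_swap]
  -- With `a_p = φ_p(n) ψ_{s-p}(n + j)` the summand is `a_{p+1} - a_p`.
  have h2 : ∑ p ∈ Finset.range s, (lApply x (φ p) n * ψ (s - 1 - p) (n + j)
      - φ p n * lApplyT x (ψ (s - 1 - p)) (n + j))
      = φ s n * ψ 0 (n + j) - φ 0 n * ψ s (n + j) := by
    have := Finset.sum_range_sub (fun p => φ p n * ψ (s - p) (n + j)) s
    simp only [Nat.sub_self, Nat.sub_zero] at this
    rw [← this]
    refine Finset.sum_congr rfl fun p hp => ?_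
    rw [Finset.mem_range] at hp
    have e1 : lApply x (φ p) = φ (p + 1) := (Function.iterate_succ_apply' _ _ _).symm
    have e2 : lApplyT x (ψ (s - 1 - p)) = ψ (s - p) := by
      rw [show s - p = s - 1 - p + 1 by omega]
      exact (Function.iterate_succ_apply' _ _ _).symm
    rw [e1, e2, show s - (p + 1) = s - 1 - p by omega]
  rw [h1, Finset.sum_congr rfl fun p _ => hx.opComm_sandwich1 (hφ2 p) (hψ2 _) hj n,
    Finset.sum_sub_distrib, h2, Finset.sum_comm]
  -- The two surviving ends are the `δ_k^i l^s` terms of the flow, spread over `i` so that the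
  -- comparison is termwise.
  have h3 : φ s n * ψ 0 (n + j) - φ 0 n * ψ s (n + j)
      = ∑ i, ((if i = k then φ s n * x.2.2 i (n + j) else 0)
        - if i = k then x.2.1 i n * ψ s (n + j) else 0) := by
    rw [Finset.sum_sub_distrib, Finset.sum_ite_eq' Finset.univ k,
      Finset.sum_ite_eq' Finset.univ k]
    simp [hφ, hψ]
  rw [h3, ← Finset.sum_sub_distrib]
  refine Finset.sum_congr rfl fun i _ => ?_
  have h4 : (flow k s x).2.1 i n = -∑ p ∈ Finset.range s,
      φ p n * shiftInv (x.2.1 i * ψ (s - 1 - p)) n + if i = k then φ s n else 0 := by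
    simp only [flow, sqApply, Pi.add_apply, Pi.neg_apply, Finset.sum_apply, Pi.mul_apply, hφ, hψ,
      mul_comm (x.2.1 i)]
    congr 1
    split_ifs with h
    · rw [h]
    · rfl
  have h5 : (flow k s x).2.2 i (n + j) = -∑ p ∈ Finset.range s,
      shiftShiftInv (x.2.2 i * φ p) (n + j) * ψ (s - 1 - p) (n + j)
        - if i = k then ψ s (n + j) else 0 := by
    simp only [flow, sqApplyT, shiftInvT_eq_neg, Pi.sub_apply, Pi.neg_apply, Finset.sum_apply,
      Pi.mul_apply, hφ, hψ, mul_comm (x.2.2 i), mul_neg, Finset.sum_neg_distrib]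
    congr 1
    · congr 1
      exact Finset.sum_congr rfl fun p _ => mul_comm _ _
    · split_ifs with h
      · rw [h]
      · rfl
  rw [h4, h5, Finset.sum_add_distrib, ← Finset.mul_sum, ← Finset.sum_mul]
  split_ifs <;> ring

/-! ### Bounded operators on `ℓ²` -/

/-- The restriction of `T` to `ℓ²` is a bounded linear operator. -/
def IsBddOp (T : Seq → Seq) : Prop :=
  ∃ A : lp (fun _ : ℤ => ℂ) 2 →L[ℂ] lp (fun _ : ℤ => ℂ) 2, ∀ u, (A u : Seq) = T u

theorem norm_sq_eq_tsum (a : lp (fun _ : ℤ => ℂ) 2) : ‖a‖ ^ 2 = ∑' n, ‖a n‖ ^ 2 := by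
  have h := lp.norm_rpow_eq_tsum (p := 2) (by norm_num) a
  norm_num at h
  exact h

theorem norm_le_mul_of_shift {a b : lp (fun _ : ℤ => ℂ) 2} {C : ℝ} (hC : 0 ≤ C) (j : ℤ)
    (h : ∀ n, ‖b n‖ ≤ C * ‖a (n + j)‖) : ‖b‖ ≤ C * ‖a‖ := by
  refine (pow_le_pow_iff_left₀ (norm_nonneg _) (by positivity) two_ne_zero).mp ?_
  rw [mul_pow, norm_sq_eq_tsum, norm_sq_eq_tsum, ← tsum_mul_left,
    ← (Equiv.addRight j).tsum_eq fun n => C ^ 2 * ‖a n‖ ^ 2]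
  have ha : Summable fun n => C ^ 2 * ‖a (n + j)‖ ^ 2 :=
    (isL2_iff.mp (IsL2.shift (lp.memℓp a) j)).mul_left _
  refine Summable.tsum_le_tsum (fun n => ?_) (isL2_iff.mp (lp.memℓp b)) ha
  rw [Equiv.coe_addRight, ← mul_pow]
  exact pow_le_pow_left₀ (norm_nonneg _) (h n) 2

theorem IsBddOp.of_bound {T : Seq → Seq} (hT : ∀ u, IsL2 u → IsL2 (T u))
    (hadd : ∀ u v, IsL2 u → IsL2 v → T (u + v) = T u + T v)
    (hsmul : ∀ (c : ℂ) u, T (c • u) = c • T u) (C : ℝ)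
    (hC : ∀ u : lp (fun _ : ℤ => ℂ) 2,
      ‖(⟨T u, hT u (lp.memℓp u)⟩ : lp (fun _ : ℤ => ℂ) 2)‖ ≤ C * ‖u‖) : IsBddOp T :=
  ⟨LinearMap.mkContinuous
    { toFun := fun u => ⟨T u, hT u (lp.memℓp u)⟩
      map_add' := fun u v => lp.ext (hadd u v (lp.memℓp u) (lp.memℓp v))
      map_smul' := fun c u => lp.ext (hsmul c u) } C hC, fun _ => rfl⟩

theorem IsBddOp.add {S T : Seq → Seq} (hS : IsBddOp S) (hT : IsBddOp T) :
    IsBddOp fun u => S u + T u := by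
  obtain ⟨A, hA⟩ := hS
  obtain ⟨B, hB⟩ := hT
  exact ⟨A + B, fun u => (lp.coeFn_add _ _).trans (congrArg₂ _ (hA u) (hB u))⟩

theorem IsBddOp.sum {ι : Type*} {S : Finset ι} {T : ι → Seq → Seq} (hT : ∀ i, IsBddOp (T i)) :
    IsBddOp fun u => ∑ i ∈ S, T i u := by
  choose A hA using hT
  refine ⟨∑ i ∈ S, A i, fun u => ?_⟩
  rw [sum_apply, lp.coeFn_sum]
  exact Finset.sum_congr rfl fun i _ => hA i u

theorem isBddOp_shift_mul {c : Seq} (hc : IsBdd c) (j : ℤ) :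
    IsBddOp fun u => (fun n => u (n + j)) * c := by
  obtain ⟨C, hC⟩ := id hc
  have hC0 : 0 ≤ C := (norm_nonneg _).trans (hC 0)
  refine IsBddOp.of_bound (fun u hu => (hu.shift j).mul_bdd hc) (fun u v _ _ => ?_)
    (fun a u => ?_) C fun u => norm_le_mul_of_shift hC0 j fun n => ?_
  · funext n
    exact add_mul _ _ _
  · funext n
    exact mul_assoc _ _ _
  · change ‖u (n + j) * c n‖ ≤ _
    rw [norm_mul, mul_comm]
    exact mul_le_mul_of_nonneg_right (hC n) (norm_nonneg _)

/-- The kernel has modulus `1/2` and Cauchy–Schwarz bounds `g u` in `ℓ¹`, so the second factor is at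
most `½ ‖g‖ ‖u‖` in sup norm; multiplying by `f` costs `‖f‖`. -/
theorem isBddOp_mul_shiftShiftInv {f g : Seq} (hf : IsL2 f) (hg : IsL2 g) :
    IsBddOp fun u => f * shiftShiftInv (g * u) := by
  let f' : lp (fun _ : ℤ => ℂ) 2 := ⟨f, hf⟩
  let g' : lp (fun _ : ℤ => ℂ) 2 := ⟨g, hg⟩
  refine IsBddOp.of_bound
    (fun u hu => hf.mul_bdd (isBdd_shiftShiftInv (hg.summable_mul hu))) (fun u v hu hv => ?_)
    (fun a u => ?_) (1 / 2 * ‖g'‖ * ‖f'‖) fun u => ?_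
  · rw [mul_add, shiftShiftInv_add (hg.summable_mul hu) (hg.summable_mul hv), mul_add]
  · rw [mul_smul_comm, shiftShiftInv_smul, mul_smul_comm]
  · have h := lp.tsum_mul_le_mul_norm (p := 2) (q := 2)
      (by simpa using Real.HolderConjugate.two_two) g' u
    have hle := norm_le_mul_of_shift (a := f') (C := 1 / 2 * (‖g'‖ * ‖u‖)) (by positivity) 0
      (b := ⟨f * shiftShiftInv (g * u), hf.mul_bdd (isBdd_shiftShiftInv
        (hg.summable_mul (lp.memℓp u)))⟩) fun n => ?_
    · exact hle.trans (le_of_eq (by ring))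
    · change ‖f n * shiftInv (g * u) (n + 1)‖ ≤ _ * ‖f (n + 0)‖
      rw [norm_mul, mul_comm, add_zero]
      refine mul_le_mul_of_nonneg_right ((norm_shiftInv_le (hg.summable_mul (lp.memℓp u)) _).trans
        (mul_le_mul_of_nonneg_left (le_trans (le_of_eq ?_) h.2) (by norm_num))) (norm_nonneg _)
      exact tsum_congr fun n => norm_mul _ _

theorem isBddOp_opApply {a : Op} {S : Finset ℤ} (h : ∀ j ∉ S, a j = 0) (hb : ∀ j, IsBdd (a j)) :
    IsBddOp (opApply a) := by
  have : opApply a = fun u => ∑ j ∈ S, (fun n => u (n + j)) * a j := funext (opApply_eq_sum' h)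
  rw [this]
  exact IsBddOp.sum fun j => isBddOp_shift_mul (hb j) j

/-! ### The derivative of `λ_k^s` -/

/-- The derivative of `l u` in the direction `δ`. -/
noncomputable def lApplyDeriv (x δ : Ext N) (u : Seq) : Seq :=
  opApply δ.1 u + ∑ i, (δ.2.1 i * shiftShiftInv (x.2.2 i * u)
    + x.2.1 i * shiftShiftInv (δ.2.2 i * u))

theorem IsVariation.eq_zero {m : ℕ} {δ : Ext N} (hδ : IsVariation m δ) :
    ∀ j ∉ Finset.Icc 1 (m : ℤ), δ.1 j = 0 := by
  intro j hj
  rw [Finset.mem_Icc, not_and_or] at hj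
  rcases hj with hj | hj
  · exact hδ.low j (by omega)
  · exact hδ.top j (by omega)

theorem IsVariation.isBdd {m : ℕ} {δ : Ext N} (hδ : IsVariation m δ) (j : ℤ) :
    IsBdd (δ.1 j) := .of_summable (hδ.coeff j)

theorem opPos_backlund {m : ℕ} {x δ : Ext N} (hδ : IsVariation m δ) (t : ℂ) :
    opPos (backlund (coords x + t • δ)).1 = opPos x.1 + t • δ.1 := by
  funext j
  rcases lt_or_ge 0 j with hj | hj
  · simp [opPos, hj, backlund, coords, sandwich0_of_pos hj, Finset.sum_apply]
  · simp [opPos, hj.not_gt, hδ.low j hj]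

/-- Along a line in the coordinates, `l` is quadratic in the parameter. -/
theorem lApply_backlund {m : ℕ} {x δ : Ext N} (hx : IsPhasePoint m x) (hδ : IsVariation m δ)
    (t : ℂ) {u : Seq} (hu : IsL2 u) :
    lApply (backlund (coords x + t • δ)) u = lApply x u + t • lApplyDeriv x δ u
      + t ^ 2 • ∑ i, δ.2.1 i * shiftShiftInv (δ.2.2 i * u) := by
  have h0 : ∀ j ∉ Finset.Icc 1 (m : ℤ), (t • δ.1) j = 0 := fun j hj => by
    simp [hδ.eq_zero j hj]
  have h1 : ∀ i, (backlund (coords x + t • δ)).2.1 i = x.2.1 i + t • δ.2.1 i := fun i => rfl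
  have h2 : ∀ i, (backlund (coords x + t • δ)).2.2 i = x.2.2 i + t • δ.2.2 i := fun i => rfl
  have h3 : ∀ i, shiftShiftInv ((x.2.2 i + t • δ.2.2 i) * u)
      = shiftShiftInv (x.2.2 i * u) + t • shiftShiftInv (δ.2.2 i * u) := fun i => by
    rw [add_mul, smul_mul_assoc, shiftShiftInv_add ((hx.adj i).summable_mul hu)
      (b := t • (δ.2.2 i * u)) (((hδ.adj i).summable_mul hu).const_smul t), shiftShiftInv_smul]
  unfold lApply lApplyDeriv
  rw [opPos_backlund hδ, opApply_add hx.opPos_eq_zero h0, opApply_smul_left t hδ.eq_zero]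
  simp only [h1, h2, h3]
  simp only [smul_add, Finset.smul_sum]
  have h4 : ∀ i, (x.2.1 i + t • δ.2.1 i) *
      (shiftShiftInv (x.2.2 i * u) + t • shiftShiftInv (δ.2.2 i * u))
      = x.2.1 i * shiftShiftInv (x.2.2 i * u)
        + (t • (δ.2.1 i * shiftShiftInv (x.2.2 i * u))
          + t • (x.2.1 i * shiftShiftInv (δ.2.2 i * u)))
        + t ^ 2 • (δ.2.1 i * shiftShiftInv (δ.2.2 i * u)) := fun i => by
    funext n
    simp only [Pi.add_apply, Pi.mul_apply, Pi.smul_apply, smul_eq_mul]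
    ring
  simp only [h4, Finset.sum_add_distrib]
  abel

theorem IsPhasePoint.isBddOp_lApply {m : ℕ} {x : Ext N} (hx : IsPhasePoint m x) :
    IsBddOp (lApply x) :=
  (isBddOp_opApply hx.opPos_eq_zero hx.isBdd_opPos).add
    (.sum fun i => isBddOp_mul_shiftShiftInv (hx.fn i) (hx.adj i))

theorem IsPhasePoint.isBddOp_lApplyDeriv {m : ℕ} {x δ : Ext N} (hx : IsPhasePoint m x)
    (hδ : IsVariation m δ) : IsBddOp (lApplyDeriv x δ) :=
  (isBddOp_opApply hδ.eq_zero hδ.isBdd).add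
    (.sum fun i => (isBddOp_mul_shiftShiftInv (hδ.fn i) (hx.adj i)).add
      (isBddOp_mul_shiftShiftInv (hx.fn i) (hδ.adj i)))

/-- Along a coordinate line `l` is a quadratic polynomial in `t` with bounded operators on `ℓ²` as
coefficients, so the product rule applies to `l^s f_k` in norm. -/
theorem IsPhasePoint.hasDerivAt_lam {m : ℕ} {x δ : Ext N} (hx : IsPhasePoint m x)
    (hδ : IsVariation m δ) (k : Fin N) (s : ℕ) :
    HasDerivAt (fun t : ℂ => lam k s (backlund (coords x + t • δ)))
      (dot (δ.2.2 k) ((lApply x)^[s] (x.2.1 k)) + (dot ((lApplyT x)^[s] (x.2.2 k)) (δ.2.1 k)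
        + ∑ p ∈ Finset.range s, dot ((lApplyT x)^[s - 1 - p] (x.2.2 k))
          (lApplyDeriv x δ ((lApply x)^[p] (x.2.1 k))))) 0 := by
  obtain ⟨B, hB⟩ := exists_bilinear_dot
  obtain ⟨A₀, hA₀⟩ := hx.isBddOp_lApply
  obtain ⟨A₁, hA₁⟩ := hx.isBddOp_lApplyDeriv hδ
  obtain ⟨A₂, hA₂⟩ := IsBddOp.sum (S := Finset.univ)
    fun i => isBddOp_mul_shiftShiftInv (hδ.fn i) (hδ.adj i)
  set A : ℂ → lp (fun _ : ℤ => ℂ) 2 →L[ℂ] lp (fun _ : ℤ => ℂ) 2 :=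
    fun t => A₀ + t • A₁ + t ^ 2 • A₂ with hA
  have hA0 : A 0 = A₀ := by simp [hA]
  have hAl : ∀ t u, (A t u : Seq) = lApply (backlund (coords x + t • δ)) u := fun t u => by
    rw [lApply_backlund hx hδ t (lp.memℓp u)]
    simp only [hA, add_apply, smul_apply, lp.coeFn_add,
      lp.coeFn_smul, hA₀, hA₁, hA₂]
  have hAd : HasDerivAt A A₁ 0 := by
    have h1 := (hasDerivAt_id (0 : ℂ)).smul_const A₁
    have h2 := ((hasDerivAt_id (0 : ℂ)).pow 2).smul_const A₂
    have h3 := (h1.const_add A₀).add h2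
    simp only [one_smul, id, Nat.cast_ofNat, Nat.add_one_sub_one, pow_one, mul_zero,
      mul_one, zero_smul, add_zero] at h3
    exact h3
  let F : lp (fun _ : ℤ => ℂ) 2 := ⟨x.2.1 k, hx.fn k⟩
  let dF : lp (fun _ : ℤ => ℂ) 2 := ⟨δ.2.1 k, hδ.fn k⟩
  let Fs : lp (fun _ : ℤ => ℂ) 2 := ⟨x.2.2 k, hx.adj k⟩
  let dFs : lp (fun _ : ℤ => ℂ) 2 := ⟨δ.2.2 k, hδ.adj k⟩
  have hline : ∀ a b : lp (fun _ : ℤ => ℂ) 2, HasDerivAt (fun t : ℂ => a + t • b) b 0 :=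
    fun a b => by simpa using ((hasDerivAt_id (0 : ℂ)).smul_const b).const_add a
  let u : ℕ → ℂ → lp (fun _ : ℤ => ℂ) 2 := fun p t => (fun v => A t v)^[p] (F + t • dF)
  have hu : ∀ p t, (u p t : Seq) = (lApply (backlund (coords x + t • δ)))^[p]
      ((backlund (coords x + t • δ)).2.1 k) := by
    intro p t
    induction p with
    | zero => rfl
    | succ p ih =>
      simp only [u, Function.iterate_succ_apply'] at ih ⊢
      rw [hAl, ih]
  have hu0 : ∀ p, (u p 0 : Seq) = (lApply x)^[p] (x.2.1 k) := by
    intro p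
    induction p with
    | zero => simp [u, F]
    | succ p ih =>
      rw [Function.iterate_succ_apply', ← ih, ← hA₀, ← hA0]
      simp only [u, Function.iterate_succ_apply']
  -- The exponent `q` stays free: each further factor `l` applied to `w` is transposed to the left
  -- and raises `q` by one.
  have key : ∀ p, ∃ w, HasDerivAt (u p) w 0 ∧ ∀ q, dot ((lApplyT x)^[q] (x.2.2 k)) w =
      dot ((lApplyT x)^[q + p] (x.2.2 k)) (δ.2.1 k) + ∑ i ∈ Finset.range p,
        dot ((lApplyT x)^[q + p - 1 - i] (x.2.2 k))
          (lApplyDeriv x δ ((lApply x)^[i] (x.2.1 k))) := by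
    intro p
    induction p with
    | zero => exact ⟨dF, hline F dF, fun q => by simp [dF]⟩
    | succ p ih =>
      obtain ⟨w, hw, hq⟩ := ih
      refine ⟨A₁ (u p 0) + A 0 w, ?_, fun q => ?_⟩
      · have h1 := hAd.clm_apply hw
        refine h1.congr_of_eventuallyEq (Filter.Eventually.of_forall fun t => ?_)
        simp only [u, Function.iterate_succ_apply']
      · have hψ := hx.isL2_iterateT (hx.adj k) q
        rw [lp.coeFn_add, dot_add_right hψ (lp.memℓp _) (lp.memℓp _), hA0, hA₁, hA₀, hu0,
          hx.dot_lApply hψ (lp.memℓp w), ← Function.iterate_succ_apply' (lApplyT x), hq (q + 1),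
          Finset.sum_range_succ, show q + 1 + p = q + (p + 1) by ring,
          show q + (p + 1) - 1 - p = q by omega]
        ring
  obtain ⟨w, hw, hq⟩ := key s
  have hBd := ((B.hasFDerivAt.comp_hasDerivAt (0 : ℂ) (hline Fs dFs)).clm_apply hw)
  have hval := hq 0
  rw [Nat.zero_add] at hval
  rw [← hval]
  refine (hBd.congr_of_eventuallyEq (Filter.Eventually.of_forall fun t => ?_)).congr_deriv ?_
  · simp only [lam, Function.comp, hB, hu]
    rfl
  · simp only [Function.comp, hB, hu0, zero_smul, add_zero]
    rfl

/-! ### The pairing with tangent vectors -/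

theorem IsL2.of_summable {a : Seq} (ha : Summable a) : IsL2 a := by
  obtain ⟨C, hC⟩ := IsBdd.of_summable ha
  rw [isL2_iff]
  refine Summable.of_nonneg_of_le (fun n => by positivity) (fun n => ?_) (ha.norm.mul_left C)
  rw [pow_two]
  exact mul_le_mul_of_nonneg_right (hC n) (norm_nonneg _)

theorem opMul_sum_right {ι : Type*} (S : Finset ι) {a : Op} {b : ι → Op} {d e : ℤ}
    (ha : ∀ i, d < i → a i = 0) (hb : ∀ p ∈ S, ∀ i, e < i → b p i = 0) :
    opMul a (∑ p ∈ S, b p) = ∑ p ∈ S, opMul a (b p) := by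
  classical
  induction S using Finset.induction_on with
  | empty =>
    funext j n
    simp [opMul]
  | insert p S hp ih =>
    have hS : ∀ q ∈ S, ∀ i, e < i → b q i = 0 := fun q hq => hb q (by simp [hq])
    rw [Finset.sum_insert hp, Finset.sum_insert hp, ← ih hS]
    refine opMul_add_right ha (hb p (by simp)) fun i hi => ?_
    rw [Finset.sum_apply]
    exact Finset.sum_eq_zero fun q hq => hS q hq i hi

/-- The sandwich has degrees `≤ 0`, so only `r_+` reaches degree zero, and the coefficient there is
the product `(r_+ f) g` of two `ℓ²` sequences. -/
theorem hasSum_opMul_sandwich0 {r : Op} {d : ℤ} (hr : ∀ j, d < j → r j = 0)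
    (hb : ∀ j, IsBdd (r j)) {f g : Seq} (hf : IsL2 f) (hg : IsL2 g) :
    HasSum (opMul r (sandwich0 f g) 0) (dot (opApply (opNonneg r) f) g) := by
  have h : opMul r (sandwich0 f g) 0 = opApply (opNonneg r) f * g := by
    funext n
    rw [opMul_eq_sum_of (S := Finset.Icc 0 d), Pi.mul_apply,
      opApply_eq_sum (opNonneg_eq_zero hr), Finset.sum_mul]
    · refine Finset.sum_congr rfl fun i hi => ?_
      rw [Finset.mem_Icc] at hi
      rw [sandwich0_of_nonpos (by omega), opNonneg, if_pos hi.1, show n + i + (0 - i) = n by ring]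
      ring
    · intro i hi
      rw [Finset.mem_Icc, not_and_or] at hi
      rcases hi with hi | hi
      · rw [sandwich0_of_pos (by omega)]
        simp
      · rw [hr i (by omega)]
        simp
  rw [h]
  exact ((isL2_opApply (opNonneg_eq_zero hr) (isBdd_opNonneg hb) hf).summable_mul hg).hasSum

theorem hasSum_opMul_variation {m : ℕ} {δ : Ext N} (hδ : IsVariation m δ) {r : Op}
    (hb : ∀ j, IsBdd (r j)) :
    HasSum (opMul r δ.1 0)
      (∑ j ∈ Finset.Icc 1 (m : ℤ), dot (r (-j)) fun n => δ.1 j (n + -j)) := by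
  have h : opMul r δ.1 0 =
      fun n => ∑ j ∈ Finset.Icc 1 (m : ℤ), r (-j) n * δ.1 j (n + -j) := by
    funext n
    rw [opMul_eq_sum_of (S := Finset.Icc (-(m : ℤ)) (-1)), sum_Icc_reflect _ 0]
    · simp only [zero_sub, neg_neg]
    · intro i hi
      rw [hδ.eq_zero (0 - i) (by rw [Finset.mem_Icc] at hi ⊢; omega)]
      simp
  rw [h]
  refine hasSum_sum fun j _ => Summable.hasSum ?_
  have := Summable.mul_isBdd (Summable.shift (hδ.coeff j) (-j)) (hb (-j))
  rwa [mul_comm] at this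

/-- Computes the transpose of `backlundDeriv`: the variation of the sandwich part of `l` feeds `r_+`
into the other components. The right-hand side shows which combinations of `r`, `χ`, `ρ` the
variations can detect. -/
theorem pairing_backlundDeriv {m : ℕ} {x δ G : Ext N} (hx : IsPhasePoint m x)
    (hδ : IsVariation m δ) (hG : IsCovector G) :
    pairing G (backlundDeriv (coords x) δ) =
      ∑ j ∈ Finset.Icc 1 (m : ℤ), dot (G.1 (-j)) (fun n => δ.1 j (n + -j))
      + ∑ i, (dot (G.2.1 i + opApplyT (opNonneg G.1) (x.2.2 i)) (δ.2.1 i)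
        + dot (G.2.2 i + opApply (opNonneg G.1) (x.2.1 i)) (δ.2.2 i)) := by
  obtain ⟨d, hd⟩ := hG.top
  have hb : ∀ j, IsBdd (G.1 j) := hG.coeff
  have hs := opNonneg_eq_zero hd
  have hsb := isBdd_opNonneg hb
  have e0 : ∀ u v : Seq, ∀ i : ℤ, (m : ℤ) < i → sandwich0 u v i = 0 :=
    fun u v i hi => sandwich0_of_pos (by omega) u v
  have e1 : ∀ j : Fin N, ∀ i : ℤ, (m : ℤ) < i →
      (sandwich0 (δ.2.1 j) (x.2.2 j) + sandwich0 (x.2.1 j) (δ.2.2 j)) i = 0 :=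
    fun j i hi => by simp [e0 _ _ i hi]
  have e2 : trPair G.1 (backlundDeriv (coords x) δ).1 =
      ∑ j ∈ Finset.Icc 1 (m : ℤ), dot (G.1 (-j)) (fun n => δ.1 j (n + -j))
      + ∑ i, (dot (opApply (opNonneg G.1) (δ.2.1 i)) (x.2.2 i)
        + dot (opApply (opNonneg G.1) (x.2.1 i)) (δ.2.2 i)) := by
    refine HasSum.tsum_eq ?_
    have e3 : opMul G.1 (backlundDeriv (coords x) δ).1 = opMul G.1 δ.1
        + ∑ i, (opMul G.1 (sandwich0 (δ.2.1 i) (x.2.2 i))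
          + opMul G.1 (sandwich0 (x.2.1 i) (δ.2.2 i))) := by
      simp only [backlundDeriv, coords]
      rw [opMul_add_right hd (e := m) (fun i hi => hδ.top i hi.le),
        opMul_sum_right _ hd (fun j _ => e1 j)]
      · congr 1
        exact Finset.sum_congr rfl fun j _ => opMul_add_right hd (e0 _ _) (e0 _ _)
      · intro i hi
        rw [Finset.sum_apply]
        exact Finset.sum_eq_zero fun j _ => e1 j i hi
    rw [e3]
    simp only [Pi.add_apply, Finset.sum_apply]
    refine (hasSum_opMul_variation hδ hb).add ?_
    convert hasSum_sum (s := Finset.univ) fun i _ =>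
      (hasSum_opMul_sandwich0 hd hb (hδ.fn i) (hx.adj i)).add
        (hasSum_opMul_sandwich0 hd hb (hx.fn i) (hδ.adj i)) using 1
    funext n
    rw [Finset.sum_apply]
    rfl
  rw [pairing, e2, add_assoc, ← Finset.sum_add_distrib]
  congr 1
  refine Finset.sum_congr rfl fun i _ => ?_
  rw [dot_add_left (hδ.fn i) (hG.fn i) (isL2_opApplyT hs hsb (hx.adj i)),
    dot_add_left (hδ.adj i) (hG.adj i) (isL2_opApply hs hsb (hx.fn i)),
    ← dot_opApply hs hsb (hx.adj i) (hδ.fn i), dot_comm (x.2.2 i)]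
  simp only [backlundDeriv]
  ring

theorem IsVariation.add_smul {m : ℕ} {δ v : Ext N} (hδ : IsVariation m δ) (hv : IsVariation m v)
    (c : ℂ) : IsVariation m (δ + c • v) where
  low j hj := by simp [hδ.low j hj, hv.low j hj]
  top j hj := by simp [hδ.top j hj, hv.top j hj]
  coeff j := (hδ.coeff j).add ((hv.coeff j).const_smul c)
  fn i := (hδ.fn i).add ((hv.fn i).smul c)
  adj i := (hδ.adj i).add ((hv.adj i).smul c)

theorem dot_add_smul_right {a b c : Seq} (ha : IsL2 a) (hb : IsL2 b) (hc : IsL2 c) (z : ℂ) :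
    dot a (b + z • c) = dot a b + z * dot a c := by
  rw [dot_add_right ha hb (hc.smul z), dot_smul_right]

theorem dot_add_smul_of_summable {a b c : Seq} (ha : IsBdd a) (hb : Summable b) (hc : Summable c)
    (z : ℂ) : dot a (b + z • c) = dot a b + z * dot a c := by
  rw [← dot_smul_right, dot, dot, dot]
  have h1 := Summable.mul_isBdd hb ha
  have h2 := Summable.mul_isBdd (hc.const_smul z) ha
  rw [mul_comm] at h1 h2
  refine Eq.trans (tsum_congr fun n => ?_) (h1.tsum_add h2)
  simp only [Pi.add_apply, Pi.mul_apply, mul_add]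

theorem pairing_add_smul {m : ℕ} {x δ v G : Ext N} (hx : IsPhasePoint m x)
    (hδ : IsVariation m δ) (hv : IsVariation m v) (hG : IsCovector G) (c : ℂ) :
    pairing G (backlundDeriv (coords x) (δ + c • v)) =
      pairing G (backlundDeriv (coords x) δ) + c * pairing G (backlundDeriv (coords x) v) := by
  obtain ⟨d, hd⟩ := hG.top
  have hb : ∀ j, IsBdd (G.1 j) := hG.coeff
  have hs := opNonneg_eq_zero hd
  have hsb := isBdd_opNonneg hb
  rw [pairing_backlundDeriv hx hδ hG, pairing_backlundDeriv hx hv hG,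
    pairing_backlundDeriv hx (hδ.add_smul hv c) hG, mul_add, Finset.mul_sum, Finset.mul_sum,
    add_add_add_comm, ← Finset.sum_add_distrib, ← Finset.sum_add_distrib]
  congr 1
  · refine Finset.sum_congr rfl fun j _ => ?_
    rw [← dot_add_smul_of_summable (hb (-j)) (Summable.shift (hδ.coeff j) (-j))
      (Summable.shift (hv.coeff j) (-j))]
    rfl
  · refine Finset.sum_congr rfl fun i _ => ?_
    have h1 := (hG.fn i).add (isL2_opApplyT hs hsb (hx.adj i))
    have h2 := (hG.adj i).add (isL2_opApply hs hsb (hx.fn i))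
    have h3 := dot_add_smul_right h1 (hδ.fn i) (hv.fn i) c
    have h4 := dot_add_smul_right h2 (hδ.adj i) (hv.adj i) c
    refine (congrArg₂ (· + ·) h3 h4).trans ?_
    ring

/-- The pairing with all variations determines a gradient up to the kernel of the transpose of
`backlundDeriv`. -/
theorem eq_of_pairing_eq {m : ℕ} {x G G' : Ext N} (hx : IsPhasePoint m x) (hG : IsCovector G)
    (hG' : IsCovector G')
    (h : ∀ δ, IsVariation m δ → pairing G (backlundDeriv (coords x) δ)
      = pairing G' (backlundDeriv (coords x) δ)) :
    (∀ j : ℤ, 0 < j → j < m → G.1 (-j) = G'.1 (-j)) ∧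
    (∀ i, G.2.1 i + opApplyT (opNonneg G.1) (x.2.2 i)
      = G'.2.1 i + opApplyT (opNonneg G'.1) (x.2.2 i)) ∧
    ∀ i, G.2.2 i + opApply (opNonneg G.1) (x.2.1 i)
      = G'.2.2 i + opApply (opNonneg G'.1) (x.2.1 i) := by
  classical
  have hs : ∀ (i j : Fin N) (n : ℤ), IsL2 ((Pi.single i (Pi.single n 1) : Fin N → Seq) j) := by
    intro i j n
    rcases eq_or_ne j i with rfl | hij
    · rw [Pi.single_eq_same]
      exact isL2_single n
    · rw [Pi.single_eq_of_ne hij]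
      exact isL2_zero
  have hdot : ∀ (a : Fin N → Seq) (i : Fin N) (n : ℤ),
      ∑ j, dot (a j) ((Pi.single i (Pi.single n 1) : Fin N → Seq) j) = a i n := by
    intro a i n
    rw [Finset.sum_eq_single i, Pi.single_eq_same, dot_single_right]
    · intro j _ hij
      rw [Pi.single_eq_of_ne hij, dot_zero_right]
    · simp
  refine ⟨fun j hj hjm => funext fun n => ?_, fun i => funext fun n => ?_,
    fun i => funext fun n => ?_⟩
  -- The pairing evaluates `δa_j` at sites shifted by `-j`, so a unit mass at `n - j` reads off
  -- `r_{-j}(n)`.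
  · have hδ : IsVariation m ((Pi.single j (Pi.single (n - j) 1), 0, 0) : Ext N) := by
      refine ⟨fun c hc => ?_, fun c hc => ?_, fun c => ?_, fun _ => isL2_zero, fun _ => isL2_zero⟩
      · exact Pi.single_eq_of_ne (by omega) _
      · exact Pi.single_eq_of_ne (by omega) _
      · rcases eq_or_ne c j with rfl | hcj
        · change Summable ((Pi.single c (Pi.single (n - c) 1) : Op) c)
          rw [Pi.single_eq_same]
          exact summable_single _
        · change Summable ((Pi.single j (Pi.single (n - j) 1) : Op) c)
          rw [Pi.single_eq_of_ne hcj]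
          exact summable_zero
    have hsum : ∀ r : Op, ∑ c ∈ Finset.Icc 1 (m : ℤ), dot (r (-c))
        (fun p => (Pi.single j (Pi.single (n - j) 1) : Op) c (p + -c)) = r (-j) n := by
      intro r
      rw [Finset.sum_eq_single j]
      · have : (fun p => (Pi.single j (Pi.single (n - j) 1) : Op) j (p + -j))
            = Pi.single n 1 := by
          funext p
          rw [Pi.single_eq_same, Pi.single_apply, Pi.single_apply]
          congr 1
          simp only [eq_iff_iff]
          omega
        rw [this, dot_single_right]
      · intro c _ hcj
        rw [Pi.single_eq_of_ne hcj]
        exact dot_zero_right _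
      · intro hj'
        exact absurd (Finset.mem_Icc.mpr ⟨hj, hjm.le⟩) hj'
    have := h _ hδ
    rw [pairing_backlundDeriv hx hδ hG, pairing_backlundDeriv hx hδ hG'] at this
    simpa [hsum, dot_zero_right] using this
  · have hδ : IsVariation m ((0, Pi.single i (Pi.single n 1), 0) : Ext N) :=
      ⟨fun _ _ => rfl, fun _ _ => rfl, fun _ => summable_zero, fun j => hs i j n,
        fun _ => isL2_zero⟩
    have := h _ hδ
    rw [pairing_backlundDeriv hx hδ hG, pairing_backlundDeriv hx hδ hG'] at this
    simp only [Pi.zero_apply, dot_zero_right, add_zero, hdot] at this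
    have hz : ∀ a : Seq, dot a (fun _ => 0) = 0 := dot_zero_right
    simpa [hz] using this
  · have hδ : IsVariation m ((0, 0, Pi.single i (Pi.single n 1)) : Ext N) :=
      ⟨fun _ _ => rfl, fun _ _ => rfl, fun _ => summable_zero, fun _ => isL2_zero,
        fun j => hs i j n⟩
    have := h _ hδ
    rw [pairing_backlundDeriv hx hδ hG, pairing_backlundDeriv hx hδ hG'] at this
    simp only [Pi.zero_apply, dot_zero_right, zero_add, hdot] at this
    have hz : ∀ a : Seq, dot a (fun _ => 0) = 0 := dot_zero_right
    simpa [hz] using this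

/-! ### The gradient of `λ_k^s` -/

/-- The gradient of `λ_k^s` whose operator part has only negative powers of `E`. -/
noncomputable def lamGrad (k : Fin N) (s : ℕ) (x : Ext N) : Ext N :=
  (sqOp k s x, fun i => -(flow k s x).2.2 i, fun i => (flow k s x).2.1 i)

theorem IsPhasePoint.isCovector_lamGrad {m : ℕ} {x : Ext N} (hx : IsPhasePoint m x) (k : Fin N)
    (s : ℕ) : IsCovector (lamGrad k s x) where
  top := ⟨0, fun _ hj => sqOp_of_nonneg k s x hj.le⟩
  coeff j := IsBdd.of_summable (hx.summable_sqOp k s j)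
  fn i := (hx.isL2_flow_adj k s i).neg
  adj i := hx.isL2_flow_fn k s i

theorem opNonneg_sqOp (k : Fin N) (s : ℕ) (x : Ext N) : opNonneg (sqOp k s x) = 0 := by
  funext j
  unfold opNonneg
  split_ifs with h
  · exact sqOp_of_nonneg k s x h
  · rfl

theorem opApply_zero (u : Seq) : opApply 0 u = 0 := by
  funext n
  simp [opApply]

theorem opApplyT_zero (u : Seq) : opApplyT 0 u = 0 := by
  funext n
  simp [opApplyT]

/-- Each variation is isolated by transposition. After a shift by `-j`, the factor of `δa_j` is the
degree `-j` coefficient of `φ (E - 1)⁻¹ ψ`; the minus sign at `δf_i*` comes from transposing `E (E -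
1)⁻¹`. -/
theorem dot_lApplyDeriv {m : ℕ} {x δ : Ext N} (hx : IsPhasePoint m x) (hδ : IsVariation m δ)
    {φ ψ : Seq} (hφ : IsL2 φ) (hψ : IsL2 ψ) :
    dot ψ (lApplyDeriv x δ φ) =
      ∑ j ∈ Finset.Icc 1 (m : ℤ), dot (φ * fun n => ψ (n + -j)) (fun n => δ.1 j (n + -j))
      + ∑ i, (dot (ψ * shiftShiftInv (φ * x.2.2 i)) (δ.2.1 i)
        - dot (φ * shiftInv (ψ * x.2.1 i)) (δ.2.2 i)) := by
  have h1 : ∀ i, IsL2 (δ.2.1 i * shiftShiftInv (x.2.2 i * φ)) := fun i =>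
    (hδ.fn i).mul_bdd (isBdd_shiftShiftInv ((hx.adj i).summable_mul hφ))
  have h2 : ∀ i, IsL2 (x.2.1 i * shiftShiftInv (δ.2.2 i * φ)) := fun i =>
    (hx.fn i).mul_bdd (isBdd_shiftShiftInv ((hδ.adj i).summable_mul hφ))
  unfold lApplyDeriv
  rw [dot_add_right hψ (isL2_opApply hδ.eq_zero hδ.isBdd hφ)
    (IsL2.sum fun i _ => (h1 i).add (h2 i)), dot_sum_right hψ fun i _ => (h1 i).add (h2 i),
    opApply_eq_sum' hδ.eq_zero, dot_sum_right hψ fun j _ => (hφ.shift j).mul_bdd (hδ.isBdd j)]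
  congr 1
  · refine Finset.sum_congr rfl fun j _ => ?_
    rw [← dot_shift (φ * fun n => ψ (n + -j)) (fun n => δ.1 j (n + -j)) j]
    refine tsum_congr fun n => ?_
    simp only [Pi.mul_apply, add_neg_cancel_right]
    ring
  · refine Finset.sum_congr rfl fun i _ => ?_
    rw [dot_add_right hψ (h1 i) (h2 i), dot_mul_shiftShiftInv hψ hφ (hx.fn i) (hδ.adj i),
      shiftShiftInvT_eq_neg, mul_neg, dot_neg_left, ← sub_eq_add_neg]
    congr 1
    · rw [mul_comm (δ.2.1 i), ← dot_mul_left, mul_comm (x.2.2 i)]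
    · rw [dot_comm, mul_comm (δ.2.2 i), ← dot_mul_left, mul_comm (x.2.1 i)]

theorem IsPhasePoint.dot_flow_fn {m : ℕ} {x : Ext N} (hx : IsPhasePoint m x) (k : Fin N) (s : ℕ)
    (i : Fin N) {v : Seq} (hv : IsL2 v) :
    dot ((flow k s x).2.1 i) v = -∑ p ∈ Finset.range s,
      dot ((lApply x)^[p] (x.2.1 k) *
        shiftInv ((lApplyT x)^[s - 1 - p] (x.2.2 k) * x.2.1 i)) v
      + if i = k then dot ((lApply x)^[s] (x.2.1 k)) v else 0 := by
  have h1 : ∀ p ∈ Finset.range s, IsL2 ((lApply x)^[p] (x.2.1 k) *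
      shiftInv ((lApplyT x)^[s - 1 - p] (x.2.2 k) * x.2.1 i)) := fun p _ =>
    (hx.isL2_iterate (hx.fn k) p).mul_bdd (isBdd_shiftInv
      ((hx.isL2_iterateT (hx.adj k) _).summable_mul (hx.fn i)))
  have h2 : IsL2 (if i = k then (lApply x)^[s] (x.2.1 i) else 0) := by
    split_ifs
    · exact hx.isL2_iterate (hx.fn i) s
    · exact isL2_zero
  simp only [flow, sqApply]
  rw [dot_add_left hv (IsL2.sum h1).neg h2, dot_neg_left, dot_sum_left hv h1]
  congr 1
  split_ifs with h
  · rw [h]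
  · exact dot_zero_left v

theorem IsPhasePoint.dot_flow_adj {m : ℕ} {x : Ext N} (hx : IsPhasePoint m x) (k : Fin N) (s : ℕ)
    (i : Fin N) {v : Seq} (hv : IsL2 v) :
    dot ((flow k s x).2.2 i) v = -∑ p ∈ Finset.range s,
      dot ((lApplyT x)^[s - 1 - p] (x.2.2 k) *
        shiftShiftInv ((lApply x)^[p] (x.2.1 k) * x.2.2 i)) v
      - if i = k then dot ((lApplyT x)^[s] (x.2.2 k)) v else 0 := by
  have h1 : ∀ p ∈ Finset.range s, IsL2 ((lApplyT x)^[s - 1 - p] (x.2.2 k) *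
      -shiftShiftInv ((lApply x)^[p] (x.2.1 k) * x.2.2 i)) := fun p _ =>
    (hx.isL2_iterateT (hx.adj k) _).mul_bdd (isBdd_shiftShiftInv
      ((hx.isL2_iterate (hx.fn k) p).summable_mul (hx.adj i))).neg
  have h2 : IsL2 (if i = k then (lApplyT x)^[s] (x.2.2 i) else 0) := by
    split_ifs
    · exact hx.isL2_iterateT (hx.adj i) s
    · exact isL2_zero
  simp only [flow, sqApplyT, shiftInvT_eq_neg]
  rw [dot_sub_left hv (IsL2.sum h1) h2, dot_sum_left hv h1, ← Finset.sum_neg_distrib]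
  congr 1
  · exact Finset.sum_congr rfl fun p _ => by rw [mul_neg, dot_neg_left]
  · split_ifs with h
    · rw [h]
    · exact dot_zero_left v

/-- Summing over `p`, the factors of `δa_j` assemble to `M_k^s`, and those of `δf_i`, `δf_i*` to the
`M_k^s` terms of the flow. Varying the outer `f_k*` and `f_k` supplies the terms with `l^s`. -/
theorem IsPhasePoint.hasGradientAt_lamGrad {m : ℕ} {x : Ext N} (hx : IsPhasePoint m x)
    (k : Fin N) (s : ℕ) :
    HasGradientAt {δ | IsVariation m δ} (lam k s) x (lamGrad k s x) := by
  intro δ hδ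
  have hδ' : IsVariation m δ := hδ
  refine (hx.hasDerivAt_lam hδ' k s).congr_deriv ?_
  rw [pairing_backlundDeriv hx hδ' (hx.isCovector_lamGrad k s)]
  have hφ2 := hx.isL2_iterate (hx.fn k)
  have hψ2 := hx.isL2_iterateT (hx.adj k)
  simp only [lamGrad, opNonneg_sqOp, opApply_zero, opApplyT_zero, add_zero, dot_neg_left]
  rw [Finset.sum_congr rfl fun p _ => dot_lApplyDeriv hx hδ' (hφ2 p) (hψ2 (s - 1 - p)),
    Finset.sum_add_distrib, Finset.sum_comm]
  have h1 : ∀ j ∈ Finset.Icc 1 (m : ℤ), ∑ p ∈ Finset.range s,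
      dot ((lApply x)^[p] (x.2.1 k) * fun n => (lApplyT x)^[s - 1 - p] (x.2.2 k) (n + -j))
        (fun n => δ.1 j (n + -j)) = dot (sqOp k s x (-j)) fun n => δ.1 j (n + -j) := by
    intro j hj
    rw [Finset.mem_Icc] at hj
    rw [sqOp_of_neg k s x (by omega), dot_sum_left]
    · exact IsL2.of_summable (Summable.shift (hδ'.coeff j) (-j))
    · exact fun p _ => IsL2.of_summable ((hφ2 p).summable_mul ((hψ2 _).shift (-j)))
  rw [Finset.sum_congr rfl h1]
  rw [← add_assoc, add_left_comm]
  congr 1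
  rw [Finset.sum_congr rfl fun i _ => congrArg₂ (fun a b => -a + b)
    (hx.dot_flow_adj k s i (hδ'.fn i)) (hx.dot_flow_fn k s i (hδ'.adj i)), Finset.sum_comm]
  have h2 : dot (δ.2.2 k) ((lApply x)^[s] (x.2.1 k)) + dot ((lApplyT x)^[s] (x.2.2 k)) (δ.2.1 k)
      = ∑ i, ((if i = k then dot ((lApplyT x)^[s] (x.2.2 k)) (δ.2.1 i) else 0)
        + if i = k then dot ((lApply x)^[s] (x.2.1 k)) (δ.2.2 i) else 0) := by
    rw [Finset.sum_add_distrib, Finset.sum_ite_eq' Finset.univ k,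
      Finset.sum_ite_eq' Finset.univ k]
    simp only [Finset.mem_univ, if_true]
    rw [dot_comm (δ.2.2 k)]
    ring
  rw [h2, ← Finset.sum_add_distrib]
  refine Finset.sum_congr rfl fun i _ => ?_
  rw [Finset.sum_sub_distrib]
  ring

/-! ### The flow as a Hamiltonian flow -/

/-- In positive degrees the part of `r` of degree `≥ 0` drops out of the first component of
`-Θ`, and `r` may be replaced by `b`. -/
theorem IsPhasePoint.opComm_sub_of_pos {m : ℕ} {x : Ext N} (hx : IsPhasePoint m x) {r b : Op}
    {d : ℤ} (hr : ∀ j, d < j → r j = 0) (hb : ∀ j, 0 ≤ j → b j = 0)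
    (hrb : ∀ j : ℤ, 0 < j → j < m → r (-j) = b (-j)) {j : ℤ} (hj : 0 < j) :
    opComm x.1 r j - opComm x.1 (opNonneg r) j = opComm x.1 b j := by
  -- As `l` has degree at most `m`, only degrees of `r` above `-m` contribute to positive total
  -- degree.
  have h : ∀ i : ℤ, -(m : ℤ) < i → r i - opNonneg r i = b i := by
    intro i hi
    unfold opNonneg
    split_ifs with h0
    · rw [hb i h0, sub_self]
    · have := hrb (-i) (by omega) (by omega)
      rw [neg_neg] at this
      rw [this, sub_zero]
  have h1 : ∀ i, max d 0 < i → r i = 0 := fun i hi => hr i (by omega)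
  have h2 : ∀ i, max d 0 < i → opNonneg r i = 0 := fun i hi => by
    unfold opNonneg
    rw [h1 i hi, ite_self]
  have h3 : ∀ i, max d 0 < i → b i = 0 := fun i hi => hb i (by omega)
  funext n
  simp only [opComm, Pi.sub_apply, opMul_eq_sum hx.top h1, opMul_eq_sum hx.top h2,
    opMul_eq_sum hx.top h3, opMul_eq_sum h1 hx.top, opMul_eq_sum h2 hx.top,
    opMul_eq_sum h3 hx.top]
  rw [sub_sub_sub_comm, ← Finset.sum_sub_distrib, ← Finset.sum_sub_distrib]
  congr 1
  · refine Finset.sum_congr rfl fun i hi => ?_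
    rw [Finset.mem_Icc] at hi
    rw [← mul_sub, ← h (j - i) (by omega), Pi.sub_apply]
  · refine Finset.sum_congr rfl fun i hi => ?_
    rw [Finset.mem_Icc] at hi
    rw [← sub_mul, ← h i (by omega), Pi.sub_apply]

/-- Equal pairings suffice because `Θ` sees only what the pairing sees. In degrees `≤ 0`, `[l, r_+]`
is itself a sum of sandwiches, which combine with those of `χ` and `ρ` into `χ + r_+* f*` and `ρ +
r_+ f`; in positive degrees `r_+` cancels. -/
theorem IsPhasePoint.flow_eq_neg_poissonOp {m : ℕ} {x G : Ext N} (hx : IsPhasePoint m x)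
    (k : Fin N) (s : ℕ) (hG : IsCovector G)
    (h : ∀ δ, IsVariation m δ → pairing G (backlundDeriv (coords x) δ)
      = pairing (lamGrad k s x) (backlundDeriv (coords x) δ)) :
    flow k s x = -poissonOp x G := by
  obtain ⟨h1, h2, h3⟩ := eq_of_pairing_eq hx hG (hx.isCovector_lamGrad k s) h
  simp only [lamGrad, opNonneg_sqOp, opApply_zero, opApplyT_zero, add_zero] at h1 h2 h3
  obtain ⟨d, hd⟩ := hG.top
  refine Prod.ext ?_ (Prod.ext ?_ ?_)
  · funext j
    rcases lt_or_ge 0 j with hj | hj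
    · rw [flow_fst, ← hx.opComm_sub_of_pos hd (fun j => sqOp_of_nonneg k s x) h1 hj]
      funext n
      simp [poissonOp, opPos, hj, sandwich0_of_pos hj, Finset.sum_apply]
    · funext n
      have h4 : (-poissonOp x G).1 j n = -opComm x.1 (opNonneg G.1) j n
          - ∑ i, (x.2.1 i n * G.2.1 i (n + j) - G.2.2 i n * x.2.2 i (n + j)) := by
        simp only [poissonOp, Prod.fst_neg, Pi.neg_apply, Pi.add_apply, Pi.sub_apply, opPos,
          if_neg hj.not_gt, Pi.zero_apply, Finset.sum_apply, sandwich0_of_nonpos hj]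
        ring
      rw [hx.flow_fst_nonpos k s hj, h4, hx.opComm_of_nonneg (opNonneg_eq_zero hd) hj,
        ← Finset.sum_neg_distrib, ← Finset.sum_sub_distrib]
      refine Finset.sum_congr rfl fun i _ => ?_
      have h5 := congrFun (h2 i) (n + j)
      have h6 := congrFun (h3 i) n
      simp only [Pi.add_apply, Pi.neg_apply] at h5 h6
      rw [← h6, ← neg_eq_iff_eq_neg.mpr h5]
      ring
  · funext i
    rw [← h3 i]
    simp only [poissonOp, Prod.snd_neg, Prod.fst_neg, Pi.neg_apply]
    abel
  · funext i
    rw [← neg_eq_iff_eq_neg.mpr (h2 i)]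
    simp only [poissonOp, Prod.snd_neg, Pi.neg_apply]

theorem IsPhasePoint.summable_flow_fst {m : ℕ} {x : Ext N} (hx : IsPhasePoint m x)
    (k : Fin N) (s : ℕ) (j : ℤ) : Summable ((flow k s x).1 j) := by
  have hM : ∀ i, (-1 : ℤ) < i → sqOp k s x i = 0 := fun i hi => sqOp_of_nonneg k s x (by omega)
  rw [flow_fst]
  refine Summable.sub ?_ ?_
  · simp only [funext fun n => opMul_eq_sum hx.top hM j n]
    refine summable_sum fun i _ => ?_
    rw [← funext fun n => mul_comm _ _]
    refine Summable.mul_isBdd ?_ (hx.isBdd i)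
    exact Summable.shift (hx.summable_sqOp k s (j - i)) i
  · simp only [funext fun n => opMul_eq_sum hM hx.top j n]
    exact summable_sum fun i _ =>
      Summable.mul_isBdd (hx.summable_sqOp k s i) ((hx.isBdd (j - i)).shift i)

/-- Since `M_k^s` has degree `≤ -1`, the commutator has degree below `m` and the leading coefficient
stays fixed. The variation is the positive part of the field; `flow_fst_nonpos` says that the
remaining degrees are the ones it induces. -/
theorem IsPhasePoint.isTangent_flow {m : ℕ} {x : Ext N} (hx : IsPhasePoint m x)
    (k : Fin N) (s : ℕ) : IsTangent m x (flow k s x) := by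
  have hM : ∀ i, (-1 : ℤ) < i → sqOp k s x i = 0 := fun i hi => sqOp_of_nonneg k s x (by omega)
  refine ⟨(opPos (flow k s x).1, (flow k s x).2), ⟨?_, ?_, ?_, ?_, ?_⟩, ?_⟩
  · exact fun j hj => if_neg (by omega)
  · intro j hj
    have : (flow k s x).1 j = 0 := by
      funext n
      rw [flow_fst, opComm, Pi.sub_apply, Pi.sub_apply, opMul_eq_sum hx.top hM,
        opMul_eq_sum hM hx.top, Finset.Icc_eq_empty (by omega), Finset.Icc_eq_empty (by omega)]
      simp
    simp [opPos, this]
  · intro j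
    simp only [opPos]
    split_ifs
    · exact hx.summable_flow_fst k s j
    · exact summable_zero
  · exact hx.isL2_flow_fn k s
  · exact hx.isL2_flow_adj k s
  · refine Prod.ext ?_ rfl
    funext j n
    rcases lt_or_ge 0 j with hj | hj
    · simp [backlundDeriv, opPos, hj, sandwich0_of_pos hj, Finset.sum_apply]
    · rw [hx.flow_fst_nonpos k s hj]
      simp [backlundDeriv, coords, opPos, hj.not_gt, sandwich0_of_nonpos hj, Finset.sum_apply]

/-- `⟨(M_k^s)* f_k*, f_k⟩` cancels `⟨f_k*, M_k^s f_k⟩` term by term in `p`, and likewise for `l^s`.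
The value of `μ_k` plays no role, so `μ_k` is conserved on the whole phase space. -/
theorem IsPhasePoint.muDeriv_flow {m : ℕ} {x : Ext N} (hx : IsPhasePoint m x)
    (k : Fin N) (s : ℕ) : muDeriv k x (flow k s x) = 0 := by
  have hφ2 := hx.isL2_iterate (hx.fn k)
  have hψ2 := hx.isL2_iterateT (hx.adj k)
  rw [muDeriv, dot_comm (x.2.2 k), hx.dot_flow_adj k s k (hx.fn k),
    hx.dot_flow_fn k s k (hx.adj k), if_pos rfl, if_pos rfl, ← hx.dot_iterate (hx.adj k) (hx.fn k),
    dot_comm (x.2.2 k)]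
  have h : ∀ p ∈ Finset.range s, dot ((lApplyT x)^[s - 1 - p] (x.2.2 k) *
        shiftShiftInv ((lApply x)^[p] (x.2.1 k) * x.2.2 k)) (x.2.1 k)
      = -dot ((lApply x)^[p] (x.2.1 k) *
        shiftInv ((lApplyT x)^[s - 1 - p] (x.2.2 k) * x.2.1 k)) (x.2.2 k) := by
    intro p _
    rw [dot_comm, dot_mul_shiftShiftInv (hx.fn k) (hx.adj k) (hψ2 _) (hφ2 _),
      shiftShiftInvT_eq_neg, mul_neg, dot_neg_left]
  rw [Finset.sum_congr rfl h, Finset.sum_neg_distrib]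
  ring

theorem hasDerivAt_mu {k : Fin N} {x : ℝ → Ext N} {v : Ext N} {τ : ℝ}
    (h1 : HasL2DerivAt (fun t => (x t).2.1 k) (v.2.1 k) τ)
    (h2 : HasL2DerivAt (fun t => (x t).2.2 k) (v.2.2 k) τ) :
    HasDerivAt (fun t => mu k (x t)) (muDeriv k (x τ) v) τ := by
  obtain ⟨B, hB⟩ := exists_bilinear_dot
  obtain ⟨F, F', hF, hF', hFd⟩ := h1
  obtain ⟨H, H', hH, hH', hHd⟩ := h2
  -- The product is complex bilinear, while the time parameter is real.
  have hd := (B.isBoundedBilinearMap.hasFDerivAt (H τ, F τ)).restrictScalars ℝ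
  have hc := hd.comp_hasDerivAt τ (hHd.prodMk hFd)
  refine (hc.congr_of_eventuallyEq ?_).congr_deriv ?_
  · filter_upwards [hF, hH] with t ht1 ht2
    simp only [Function.comp, hB, ht1, ht2, mu]
  · have e1 := hF.self_of_nhds
    have e2 := hH.self_of_nhds
    change B (H τ) F' + B H' (F τ) = _
    rw [hB, hB, e1, e2, hF', hH', muDeriv, add_comm]

theorem IsSolutionOn.mem_subspaceM {m : ℕ} {k : Fin N} {s : ℕ} {a b : ℝ} {x : ℝ → Ext N}
    (hx : IsSolutionOn m k s (Set.Ioo a b) x) {τ₀ : ℝ} (h₀ : τ₀ ∈ Set.Ioo a b)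
    (hM : x τ₀ ∈ subspaceM m k) {τ : ℝ} (hτ : τ ∈ Set.Ioo a b) : x τ ∈ subspaceM m k := by
  have hd : ∀ t ∈ Set.Ioo a b, HasDerivAt (fun t => mu k (x t)) 0 t := by
    intro t ht
    obtain ⟨hp, -, h1, h2⟩ := hx t ht
    have := hasDerivAt_mu (h1 k) (h2 k)
    rwa [hp.muDeriv_flow k s] at this
  refine ⟨(hx τ hτ).1, ?_⟩
  rw [← hM.2]
  exact isOpen_Ioo.is_const_of_deriv_eq_zero isPreconnected_Ioo
    (fun t ht => (hd t ht).differentiableAt.differentiableWithinAt)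
    (fun t ht => (hd t ht).deriv) hτ h₀

/-! ### Reduction to `M_k` -/

theorem IsPhasePoint.isCovector_add_muGrad {m : ℕ} {x G : Ext N} (hx : IsPhasePoint m x)
    (hG : IsCovector G) (k : Fin N) (c : ℂ) : IsCovector (G + c • muGrad k x) := by
  have h1 : (G + c • muGrad k x).1 = G.1 := by simp [muGrad]
  refine ⟨by rw [h1]; exact hG.top, by rw [h1]; exact hG.coeff, fun i => ?_, fun i => ?_⟩
  · refine (hG.fn i).add (IsL2.smul ?_ c)
    change IsL2 (if i = k then x.2.2 k else 0)
    split_ifs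
    exacts [hx.adj k, isL2_zero]
  · refine (hG.adj i).add (IsL2.smul ?_ c)
    change IsL2 (if i = k then x.2.1 k else 0)
    split_ifs
    exacts [hx.fn k, isL2_zero]

theorem pairing_add_muGrad {m : ℕ} {x δ G : Ext N} (hx : IsPhasePoint m x)
    (hδ : IsVariation m δ) (hG : IsCovector G) (k : Fin N) (c : ℂ) :
    pairing (G + c • muGrad k x) (backlundDeriv (coords x) δ) =
      pairing G (backlundDeriv (coords x) δ) + c * muDeriv k x δ := by
  have h1 : (G + c • muGrad k x).1 = G.1 := by simp [muGrad]
  have hf : ∀ i, IsL2 (if i = k then x.2.2 k else 0) := fun i => by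
    split_ifs
    exacts [hx.adj k, isL2_zero]
  have hfs : ∀ i, IsL2 (if i = k then x.2.1 k else 0) := fun i => by
    split_ifs
    exacts [hx.fn k, isL2_zero]
  have h2 : ∀ i, dot ((G + c • muGrad k x).2.1 i) (δ.2.1 i)
      = dot (G.2.1 i) (δ.2.1 i) + if i = k then c * dot (x.2.2 k) (δ.2.1 i) else 0 := by
    intro i
    refine (dot_add_left (hδ.fn i) (hG.fn i) ((hf i).smul c)).trans ?_
    rw [dot_smul_left]
    split_ifs
    · rfl
    · rw [dot_zero_left, mul_zero]
  have h3 : ∀ i, dot ((G + c • muGrad k x).2.2 i) (δ.2.2 i)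
      = dot (G.2.2 i) (δ.2.2 i) + if i = k then c * dot (x.2.1 k) (δ.2.2 i) else 0 := by
    intro i
    refine (dot_add_left (hδ.adj i) (hG.adj i) ((hfs i).smul c)).trans ?_
    rw [dot_smul_left]
    split_ifs
    · rfl
    · rw [dot_zero_left, mul_zero]
  have hb : (backlundDeriv (coords x) δ).2 = δ.2 := rfl
  rw [pairing, pairing, h1, hb]
  simp only [h2, h3]
  rw [Finset.sum_congr rfl fun i _ => add_add_add_comm _ _ _ _, Finset.sum_add_distrib,
    Finset.sum_add_distrib (f := fun i => if i = k then c * dot (x.2.2 k) (δ.2.1 i) else 0),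
    Finset.sum_ite_eq' Finset.univ k, Finset.sum_ite_eq' Finset.univ k, muDeriv,
    dot_comm (δ.2.2 k)]
  simp only [Finset.mem_univ, if_true]
  ring

theorem muDeriv_add_smul {m : ℕ} {x δ v : Ext N} (hx : IsPhasePoint m x)
    (hδ : IsVariation m δ) (hv : IsVariation m v) (k : Fin N) (c : ℂ) :
    muDeriv k x (δ + c • v) = muDeriv k x δ + c * muDeriv k x v := by
  have h1 := dot_add_smul_right (hx.fn k) (hδ.adj k) (hv.adj k) c
  have h2 := dot_add_smul_right (hx.adj k) (hδ.fn k) (hv.fn k) c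
  simp only [muDeriv, dot_comm _ (x.2.1 k)]
  refine (congrArg₂ (· + ·) h1 h2).trans ?_
  ring

/-- A gradient of the restriction of `λ_k^s` to `M_k` is completed to a gradient of `λ_k^s` by a
multiple of `∇μ_k`. -/
theorem exists_pairing_add_muGrad_eq {m : ℕ} {k : Fin N} {x G G' : Ext N} (hx : IsPhasePoint m x)
    (hμ : mu k x = 1) (hG : IsCovector G) (hG' : IsCovector G')
    (h : ∀ δ, IsVariation m δ → muDeriv k x δ = 0 → pairing G (backlundDeriv (coords x) δ)
      = pairing G' (backlundDeriv (coords x) δ)) :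
    ∃ c : ℂ, ∀ δ, IsVariation m δ →
      pairing (G + c • muGrad k x) (backlundDeriv (coords x) δ)
        = pairing G' (backlundDeriv (coords x) δ) := by
  -- Rescaling `f_k` changes `μ_k` at rate `μ_k = 1`, so this direction is transverse to the level
  -- set and `δ - dμ_k(δ) v` is an allowed variation.
  set v : Ext N := (0, fun i => if i = k then x.2.1 k else 0, 0) with hv
  have hvv : IsVariation m v := by
    refine ⟨fun _ _ => rfl, fun _ _ => rfl, fun _ => summable_zero, fun i => ?_, fun _ => isL2_zero⟩
    simp only [hv]
    split_ifs
    exacts [hx.fn k, isL2_zero]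
  have hv1 : muDeriv k x v = 1 := by
    simp only [muDeriv, hv, if_pos, Pi.zero_apply]
    rw [← hμ, mu]
    exact (congrArg (· + _) (dot_zero_left _)).trans (zero_add _)
  -- `c` is the discrepancy of the two gradients on `v`, forced by `dμ_k(v) = 1`.
  refine ⟨pairing G' (backlundDeriv (coords x) v) - pairing G (backlundDeriv (coords x) v),
    fun δ hδ => ?_⟩
  have h1 := h _ (hδ.add_smul hvv (-muDeriv k x δ))
    (by rw [muDeriv_add_smul hx hδ hvv, hv1]; ring)
  rw [pairing_add_smul hx hδ hvv hG, pairing_add_smul hx hδ hvv hG'] at h1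
  rw [pairing_add_muGrad hx hδ hG]
  linear_combination h1

/-! ### Eigenfunctions -/

theorem opApplyT_smul (a : Op) (c : ℂ) (u : Seq) : opApplyT a (c • u) = c • opApplyT a u := by
  funext n
  simp only [opApplyT, Pi.smul_apply, smul_eq_mul]
  rw [← smul_eq_mul, smul_finsum]
  exact finsum_congr fun j => by rw [smul_eq_mul]; ring

theorem lApply_smul {m : ℕ} {x : Ext N} (hx : IsPhasePoint m x) (c : ℂ) (u : Seq) :
    lApply x (c • u) = c • lApply x u := by
  simp only [lApply, opApply_smul hx.opPos_eq_zero, mul_smul_comm, shiftShiftInv_smul,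
    smul_add, Finset.smul_sum]

theorem lApplyT_smul (x : Ext N) (c : ℂ) (u : Seq) : lApplyT x (c • u) = c • lApplyT x u := by
  simp only [lApplyT, opApplyT_smul, mul_smul_comm, shiftShiftInvT_eq_neg, shiftInv_smul,
    smul_add, Finset.smul_sum, ← smul_neg]

theorem iterate_eq_pow_smul {T : Seq → Seq} (hT : ∀ (c : ℂ) u, T (c • u) = c • T u) {z : ℂ}
    {u : Seq} (hu : T u = z • u) (p : ℕ) : T^[p] u = z ^ p • u := by
  induction p with
  | zero => simp
  | succ p ih => rw [Function.iterate_succ_apply', ih, hT, hu, smul_smul, pow_succ]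

theorem sandwich1_smul_smul (c d : ℂ) (u v : Seq) :
    sandwich1 (c • u) (d • v) = (c * d) • sandwich1 u v := by
  funext j n
  simp only [sandwich1, Pi.smul_apply, smul_eq_mul, mul_ite, mul_zero]
  congr 1
  ring

/-- Each of the `s` summands of `M_k^s` becomes `z^p z^(s-1-p) M_k^1`, independent of `p`. -/
theorem IsPhasePoint.eigenfunction {m : ℕ} {x : Ext N} (hx : IsPhasePoint m x) {k : Fin N}
    (hμ : mu k x = 1) (s : ℕ) {z : ℂ} (hf : lApply x (x.2.1 k) = z • x.2.1 k)
    (hfs : lApplyT x (x.2.2 k) = z • x.2.2 k) :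
    lam k s x = z ^ s ∧ (flow k s x).1 = ((s : ℂ) * z ^ (s - 1)) • (flow k 1 x).1 := by
  have h1 := iterate_eq_pow_smul (lApply_smul hx) hf
  have h2 := iterate_eq_pow_smul (lApplyT_smul x) hfs
  constructor
  · rw [lam, h1, dot_smul_right, ← mu, hμ, mul_one]
  · have h3 : sqOp k 1 x = sandwich1 (x.2.1 k) (x.2.2 k) := by simp [sqOp]
    have h4 : sqOp k s x = ((s : ℂ) * z ^ (s - 1)) • sqOp k 1 x := by
      rw [h3, sqOp]
      have : ∀ p ∈ Finset.range s, sandwich1 ((lApply x)^[p] (x.2.1 k))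
          ((lApplyT x)^[s - 1 - p] (x.2.2 k))
          = z ^ (s - 1) • sandwich1 (x.2.1 k) (x.2.2 k) := by
        intro p hp
        rw [Finset.mem_range] at hp
        rw [h1, h2, sandwich1_smul_smul, ← pow_add, show p + (s - 1 - p) = s - 1 by omega]
      rw [Finset.sum_congr rfl this, Finset.sum_const, Finset.card_range, ← Nat.cast_smul_eq_nsmul ℂ,
        smul_smul]
    simp only [flow]
    rw [h4, opComm_smul_left _ (d := -1) (fun i hi => sqOp_of_nonneg k 1 x (by omega)) hx.top,
      smul_neg]

/-! ### The vector field at rapidly decreasing data -/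

/-- Values of `E (E - 1)⁻¹` are bounded but need not decay, so in the nonlocal terms the decay comes
from the prefactors `f_i`. -/
theorem IsPhasePoint.isRapid_lApply {m : ℕ} {x : Ext N} (hx : IsPhasePoint m x)
    (hf : ∀ i, IsRapid (x.2.1 i)) {u : Seq} (hu : IsL2 u) (hur : IsRapid u) :
    IsRapid (lApply x u) := by
  refine IsRapid.add ?_ (IsRapid.sum fun i _ =>
    (hf i).mul_bdd (isBdd_shiftShiftInv ((hx.adj i).summable_mul hu)))
  rw [opApply_eq_sum' hx.opPos_eq_zero]
  exact IsRapid.sum fun j _ => (hur.shift j).mul_bdd (hx.isBdd_opPos j)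

theorem IsPhasePoint.isRapid_lApplyT {m : ℕ} {x : Ext N} (hx : IsPhasePoint m x)
    (hfs : ∀ i, IsRapid (x.2.2 i)) {u : Seq} (hu : IsL2 u) (hur : IsRapid u) :
    IsRapid (lApplyT x u) := by
  refine IsRapid.add ?_ (IsRapid.sum fun i _ =>
    (hfs i).mul_bdd (isBdd_shiftShiftInvT ((hx.fn i).summable_mul hu)))
  rw [opApplyT_eq_sum' hx.opPos_eq_zero]
  exact IsRapid.sum fun j _ => (hur.shift (-j)).mul_bdd ((hx.isBdd_opPos j).shift (-j))

theorem IsPhasePoint.isRapid_iterate {m : ℕ} {x : Ext N} (hx : IsPhasePoint m x)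
    (hf : ∀ i, IsRapid (x.2.1 i)) (k : Fin N) (p : ℕ) : IsRapid ((lApply x)^[p] (x.2.1 k)) := by
  induction p with
  | zero => exact hf k
  | succ p ih =>
    rw [Function.iterate_succ_apply']
    exact hx.isRapid_lApply hf (hx.isL2_iterate (hx.fn k) p) ih

theorem IsPhasePoint.isRapid_iterateT {m : ℕ} {x : Ext N} (hx : IsPhasePoint m x)
    (hfs : ∀ i, IsRapid (x.2.2 i)) (k : Fin N) (p : ℕ) :
    IsRapid ((lApplyT x)^[p] (x.2.2 k)) := by
  induction p with
  | zero => exact hfs k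
  | succ p ih =>
    rw [Function.iterate_succ_apply']
    exact hx.isRapid_lApplyT hfs (hx.isL2_iterateT (hx.adj k) p) ih

theorem IsPhasePoint.isRapid_flow {m : ℕ} {x : Ext N} (hx : IsPhasePoint m x) (k : Fin N) (s : ℕ)
    (hf : ∀ i, IsRapid (x.2.1 i)) (hfs : ∀ i, IsRapid (x.2.2 i)) :
    (∀ j, IsRapid ((flow k s x).1 j)) ∧
      ∀ i, IsRapid ((flow k s x).2.1 i) ∧ IsRapid ((flow k s x).2.2 i) := by
  have hφ := hx.isRapid_iterate hf
  have hψ := hx.isRapid_iterateT hfs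
  have hM : ∀ i, (-1 : ℤ) < i → sqOp k s x i = 0 := fun i hi => sqOp_of_nonneg k s x (by omega)
  have hMr : ∀ j, IsRapid (sqOp k s x j) := by
    intro j
    rcases lt_or_ge j 0 with hj | hj
    · rw [sqOp_of_neg k s x hj]
      exact IsRapid.sum fun p _ => (hφ k p).mul_bdd ((hψ k (s - 1 - p)).isBdd.shift j)
    · rw [sqOp_of_nonneg k s x hj]
      exact isRapid_zero
  refine ⟨fun j => ?_, fun i => ⟨?_, ?_⟩⟩
  · rw [flow_fst]
    refine IsRapid.sub ?_ ?_
    · have : opMul x.1 (sqOp k s x) j = ∑ i ∈ Finset.Icc (j - -1) (m : ℤ),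
          (fun n => sqOp k s x (j - i) (n + i)) * x.1 i := by
        funext n
        rw [opMul_eq_sum hx.top hM, Finset.sum_apply]
        exact Finset.sum_congr rfl fun i _ => mul_comm _ _
      rw [this]
      exact IsRapid.sum fun i _ => ((hMr (j - i)).shift i).mul_bdd (hx.isBdd i)
    · have : opMul (sqOp k s x) x.1 j = ∑ i ∈ Finset.Icc (j - m) (-1),
          sqOp k s x i * fun n => x.1 (j - i) (n + i) := by
        funext n
        rw [opMul_eq_sum hM hx.top, Finset.sum_apply]
        rfl
      rw [this]
      exact IsRapid.sum fun i _ => (hMr i).mul_bdd ((hx.isBdd (j - i)).shift i)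
  · refine (IsRapid.sum fun p _ => (hφ k p).mul_bdd (isBdd_shiftInv
      ((hx.isL2_iterateT (hx.adj k) _).summable_mul (hx.fn i)))).neg.add ?_
    split_ifs
    exacts [hφ i s, isRapid_zero]
  · refine (IsRapid.sum fun p _ => (hψ k _).mul_bdd ?_).sub ?_
    · rw [shiftInvT_eq_neg]
      exact (isBdd_shiftShiftInv
        ((hx.isL2_iterate (hx.fn k) p).summable_mul (hx.adj i))).neg
    · split_ifs
      exacts [hψ i s, isRapid_zero]

end LatticeLax

theorem theorem3 (N m s : ℕ) (hm : 1 ≤ m) (hs : 1 ≤ s) (k : Fin N) :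
    -- The flow is tangent to the phase space and to `M_k`, and every solution that meets `M_k`
    -- stays in `M_k`.
    (∀ x ∈ subspaceM m k, IsTangent m x (flow k s x) ∧ muDeriv k x (flow k s x) = 0) ∧
    (∀ (a b : ℝ) (x : ℝ → Ext N), IsSolutionOn m k s (Set.Ioo a b) x →
      ∀ τ₀ ∈ Set.Ioo a b, x τ₀ ∈ subspaceM m k → ∀ τ ∈ Set.Ioo a b, x τ ∈ subspaceM m k) ∧
    -- On `M_k` the functional `λ_k^s` has a gradient, and the flow is `-Θ ∇λ_k^s`.
    (∀ x ∈ subspaceM m k,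
      (∃ G, IsCovector G ∧ HasGradientAt {δ | IsVariation m δ} (lam k s) x G) ∧
      ∀ G, IsCovector G → HasGradientAt {δ | IsVariation m δ} (lam k s) x G →
        flow k s x = -poissonOp x G) ∧
    -- The same for the restriction of `λ_k^s` to `M_k`, whose gradient is determined up to
    -- multiples of `∇μ_k`.
    (∀ x ∈ subspaceM m k, ∀ G, IsCovector G →
      HasGradientAt {δ | IsVariation m δ ∧ muDeriv k x δ = 0} (lam k s) x G →
        ∃ c : ℂ, flow k s x = -poissonOp x (G + c • muGrad k x)) ∧
    -- If `f_k`, `f_k*` are eigenfunctions with eigenvalue `z`, then `λ_k^s = z ^ s` and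
    -- `-[M_k^s, l] = -s z^(s-1) [M_k^1, l]`.
    (∀ x ∈ subspaceM m k, ∀ z : ℂ, lApply x (x.2.1 k) = z • x.2.1 k →
      lApplyT x (x.2.2 k) = z • x.2.2 k →
        lam k s x = z ^ s ∧ (flow k s x).1 = ((s : ℂ) * z ^ (s - 1)) • (flow k 1 x).1) ∧
    -- Rapidly decreasing data give a rapidly decreasing vector field.
    (∀ x ∈ subspaceM m k, (∀ j : ℤ, j < m → IsRapid (x.1 j)) →
      (∀ i, IsRapid (x.2.1 i) ∧ IsRapid (x.2.2 i)) →
        (∀ j, IsRapid ((flow k s x).1 j)) ∧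
        ∀ i, IsRapid ((flow k s x).2.1 i) ∧ IsRapid ((flow k s x).2.2 i)) := by
  refine ⟨fun x hx => ⟨hx.1.isTangent_flow k s, hx.1.muDeriv_flow k s⟩,
    fun a b x hx τ₀ h₀ hM τ hτ => hx.mem_subspaceM h₀ hM hτ, fun x hx => ⟨?_, fun G hG hGr => ?_⟩,
    fun x hx G hG hGr => ?_, fun x hx z hf hfs => hx.1.eigenfunction hx.2 s hf hfs,
    fun x hx _ hr => hx.1.isRapid_flow k s (fun i => (hr i).1) fun i => (hr i).2⟩
  · exact ⟨lamGrad k s x, hx.1.isCovector_lamGrad k s, hx.1.hasGradientAt_lamGrad k s⟩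
  -- Uniqueness of derivatives makes any two gradients pair equally with every variation.
  · exact hx.1.flow_eq_neg_poissonOp k s hG fun δ hδ =>
      (hGr δ hδ).unique (hx.1.hasGradientAt_lamGrad k s δ hδ)
  · obtain ⟨c, hc⟩ := exists_pairing_add_muGrad_eq hx.1 hx.2 hG (hx.1.isCovector_lamGrad k s)
      fun δ hδ hδμ => (hGr δ ⟨hδ, hδμ⟩).unique (hx.1.hasGradientAt_lamGrad k s δ hδ)
    exact ⟨c, hx.1.flow_eq_neg_poissonOp k s (hx.1.isCovector_add_muGrad hG k c) hc⟩
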